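/- Let $\mathbb{C}^n\cong\mathbb{R}^{2n}$ carry the real inner product $\langle\cdot,\cdot\rangle$ and the complex inner product $x\cdot u=\sum_i x_i\overline{u_i}$, and let $\mathbb{S}^{2n-1}$ be its unit sphere. For a set $K\subseteq\mathbb{C}^n$ let $\rho_K(u)=\sup\{t\ge 0: tu\in K\}$, $u\neq 0$, be its radial function. A star body is a compact set, star-shaped around the origin, whose radial function is continuous and positive; $\mathcal{S}_0(\mathbb{C}^n)$ denotes the set of star bodies in $\mathbb{C}^n$. Convergence in the radial metric is uniform convergence of radial functions on $\mathbb{S}^{2n-1}$. A set $K$ is $\mathbb{S}^1$-invariant if $cK=K$ for all $c\in\mathbb{S}^1\subseteq\mathbb{C}$. Let $h_A(x)=\sup\{\langle a,x\rangle:a\in A\}$ be the support function of $A$, and $V_i$ the $i$-dimensional volume. Let $C\subseteq\mathbb{C}$ be a compact convex set with the origin in its interior. For $0\ne p\in(-2,1)$ and $K\in\mathcal{S}_0(\mathbb{C}^n)$ let $\mathrm{I}_{C,p}K$ be the star body with $$\rho_{\mathrm{I}_{C,p}K}(u)^{-p}=\int_K h_{Cu}(x)^p\,dx,\qquad u\in\mathbb{S}^{2n-1},$$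 where $Cu=\{cu:c\in C\}$; for $n\ge2$ let $K^{\mathbb{S}^1}$ be the ($\mathbb{S}^1$-invariant) star body with $$\rho_{K^{\mathbb{S}^1}}(u)^{2n-2}=\frac1{2\pi}\int_{\mathbb{S}^1}\rho_K(cu)^{2n-2}\,dc,\qquad u\in\mathbb{S}^{2n-1};$$ and for an $\mathbb{S}^1$-invariant star body $K$ let the complex intersection body $\mathrm{I}_cK$ be the unique $\mathbb{S}^1$-invariant star body with $$V_2(\mathrm{I}_cK\cap\mathrm{span}_{\mathbb{C}}\{u\})=V_{2n-2}(K\cap\{x:x\cdot u=0\}),\qquad u\in\mathbb{S}^{2n-1}.$$ **Theorem.** (i) There is a constant $k_C>0$, depending only on $C$, such that for every $n\ge2$ and every $K\in\mathcal{S}_0(\mathbb{C}^n)$ the bodies $\mathrm{I}_{C,p}K$ ($0\neq p\in(-2,1)$), $K^{\mathbb{S}^1}$ and $\mathrm{I}_c(K^{\mathbb{S}^1})$ are well defined and $$\lim_{p\to-2^+}\left(\frac1{\Gamma(p+2)}\right)^{-1/p}\mathrm{I}_{C,p}K=k_C\cdot\mathrm{I}_c\bigl(K^{\mathbb{S}^1}\bigr)$$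 in the radial metric. (ii) There is a constant $k_C'>0$, depending only on $C$, such that for every $n\ge2$ and every continuous $f:\mathbb{S}^{2n-1}\to\mathbb{R}$, $$\frac1{\Gamma(p+2)}\int_{\mathbb{S}^{2n-1}}h_C(v\cdot u)^pf(v)\,dv\;\longrightarrow\;k_C'\int_{\mathbb{S}^{2n-1}\cap\{v\cdot u=0\}}f(v)\,dv,\qquad p\to-2^+,$$ uniformly in $u\in\mathbb{S}^{2n-1}$; the integrals are with respect to the spherical Lebesgue measures. -/

import Mathlib

open MeasureTheory Set Filter Topology
open scoped Pointwise

/-- `ℂⁿ` with its Euclidean norm. `inner ℝ x u` is the real inner product of `ℂⁿ ≅ ℝ²ⁿ`, and the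
complex inner product `x · u = ∑ xᵢ * conj uᵢ` (linear in `x`, conjugate linear in `u`) is
`inner ℂ u x`. Its measure `volume` is Lebesgue measure on `ℝ²ⁿ`. -/
abbrev Cn (n : ℕ) : Type := EuclideanSpace ℂ (Fin n)

noncomputable section

/-- The support function `h_A(x) = sup {⟨a, x⟩ : a ∈ A}`. -/
def supportFun {E : Type*} [NormedAddCommGroup E] [InnerProductSpace ℝ E] (A : Set E) (x : E) : ℝ :=
  sSup ((fun a => inner ℝ a x) '' A)

/-- The radial function `ρ_K(u) = sup {t ≥ 0 : t u ∈ K}` (used for `u ≠ 0`). -/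
def radialFun {n : ℕ} (K : Set (Cn n)) (u : Cn n) : ℝ :=
  sSup {t : ℝ | 0 ≤ t ∧ t • u ∈ K}

/-- Star bodies in `ℂⁿ`: compact sets, star-shaped around the origin, with continuous and positive
radial function. -/
structure IsStarBody {n : ℕ} (K : Set (Cn n)) : Prop where
  isCompact : IsCompact K
  zero_mem : (0 : Cn n) ∈ K
  starConvex : StarConvex ℝ 0 K
  radial_pos : ∀ u ∈ Metric.sphere (0 : Cn n) 1, 0 < radialFun K u
  radial_continuousOn : ContinuousOn (radialFun K) (Metric.sphere (0 : Cn n) 1)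

/-- The set, star-shaped around the origin, whose radial function on the unit sphere is `ρ`. -/
def starSet {n : ℕ} (ρ : Cn n → ℝ) : Set (Cn n) :=
  {x | x = 0 ∨ ‖x‖ ≤ ρ (‖x‖⁻¹ • x)}

theorem radialFun_starSet {n : ℕ} (ρ : Cn n → ℝ) {u : Cn n} (hu : ‖u‖ = 1) (h : 0 ≤ ρ u) :
    radialFun (starSet ρ) u = ρ u := by
  have hu0 : u ≠ 0 := by
    rintro rfl
    simp at hu
  have : {t : ℝ | 0 ≤ t ∧ t • u ∈ starSet ρ} = Icc 0 (ρ u) := by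
    ext t
    simp only [starSet, mem_ofPred_eq, mem_Icc]
    refine and_congr_right fun ht => ?_
    rcases ht.eq_or_lt with rfl | ht
    · simp [h]
    · rw [norm_smul, hu, mul_one, Real.norm_of_nonneg ht.le, smul_smul, inv_mul_cancel₀ ht.ne',
        one_smul]
      simp [ht.ne', hu0]
  rw [radialFun, this, csSup_Icc h]

/-- `S¹`-invariance: `c K = K` for all `c ∈ S¹ ⊆ ℂ`. -/
def IsCircleInvariant {n : ℕ} (K : Set (Cn n)) : Prop :=
  ∀ c : ℂ, ‖c‖ = 1 → c • K = K

/-- The set `C u = {c u : c ∈ C} ⊆ ℂⁿ`. -/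
def bodyMul {n : ℕ} (C : Set ℂ) (u : Cn n) : Set (Cn n) :=
  (fun c : ℂ => c • u) '' C

/-- The complex `L_p`-intersection body `I_{C,p} K`, with radial function given by
`ρ(u)^(-p) = ∫_K h_{Cu}(x)^p dx` for unit vectors `u`. -/
def complexLpIntersectionBody {n : ℕ} (C : Set ℂ) (p : ℝ) (K : Set (Cn n)) : Set (Cn n) :=
  starSet fun u => (∫ x in K, supportFun (bodyMul C u) x ^ p) ^ (-1 / p)

/-- The `S¹`-average `K^{S¹}` of `K`, with radial function given by
`ρ(u)^(2n-2) = (1/2π) ∫_{S¹} ρ_K(c u)^(2n-2) dc` for unit vectors `u` (for `n ≥ 2`). -/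
def circleSymmetrization {n : ℕ} (K : Set (Cn n)) : Set (Cn n) :=
  starSet fun u =>
    (Real.circleAverage (fun c : ℂ => radialFun K (c • u) ^ (2 * n - 2)) 0 1) ^
      (1 / (2 * (n : ℝ) - 2))

/-- The Lebesgue measure of the section `A ∩ W` within a linear subspace `W`, in the dimension of `W`
and with respect to the inner product that `W` inherits. -/
def sectionVolume {E : Type*} [NormedAddCommGroup E] [InnerProductSpace ℝ E]
    [FiniteDimensional ℝ E] [MeasurableSpace E] [BorelSpace E]
    (W : Submodule ℝ E) (A : Set E) : ENNReal :=
  (volume : Measure W) ((fun w : W => (w : E)) ⁻¹' A)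

/-- The integral of `f` over the section of the unit sphere with a linear subspace `W`, with respect
to the spherical Lebesgue measure of the unit sphere of `W`. -/
def sphereSectionIntegral {E : Type*} [NormedAddCommGroup E] [InnerProductSpace ℝ E]
    [FiniteDimensional ℝ E] [MeasurableSpace E] [BorelSpace E]
    (W : Submodule ℝ E) (f : Metric.sphere (0 : E) 1 → ℝ) : ℝ :=
  ∫ v : Metric.sphere (0 : W) 1,
    f ⟨((v : W) : E), mem_sphere_zero_iff_norm.2 (mem_sphere_zero_iff_norm.1 v.2)⟩
    ∂(volume : Measure W).toSphere

/-- The complex line spanned by `u`, as a real subspace (of dimension `2`). -/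
def complexLine {n : ℕ} (u : Cn n) : Submodule ℝ (Cn n) :=
  (Submodule.span ℂ {u}).restrictScalars ℝ

/-- The complex hyperplane orthogonal to `u` with respect to the complex inner product, as a real
subspace (of dimension `2n-2`). -/
def complexHyperplane {n : ℕ} (u : Cn n) : Submodule ℝ (Cn n) :=
  ((Submodule.span ℂ {u})ᗮ).restrictScalars ℝ

/-- `L` is the complex intersection body `I_c K` of the `S¹`-invariant star body `K`: it is an
`S¹`-invariant star body, and `V_2(L ∩ span_ℂ u) = V_{2n-2}(K ∩ u^⊥)` for all unit vectors `u`. -/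
structure IsComplexIntersectionBody {n : ℕ} (K L : Set (Cn n)) : Prop where
  isStarBody : IsStarBody L
  isCircleInvariant : IsCircleInvariant L
  volume_eq : ∀ u : Cn n, ‖u‖ = 1 →
    sectionVolume (complexLine u) L = sectionVolume (complexHyperplane u) K

/-- Convergence in the radial metric: uniform convergence of radial functions on the unit sphere. -/
def TendstoRadially {n : ℕ} (F : ℝ → Set (Cn n)) (l : Filter ℝ) (L : Set (Cn n)) : Prop :=
  TendstoUniformlyOn (fun p => radialFun (F p)) (radialFun L) l (Metric.sphere (0 : Cn n) 1)

/-- The operator `(J_{C,p} f)(u) = ∫_{S^{2n-1}} h_C(v · u)^p f(v) dv`, with respect to the spherical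
Lebesgue measure of `S^{2n-1}`. -/
def sphericalTransform {n : ℕ} (C : Set ℂ) (p : ℝ)
    (f : C(Metric.sphere (0 : Cn n) 1, ℝ)) (u : Metric.sphere (0 : Cn n) 1) : ℝ :=
  ∫ v : Metric.sphere (0 : Cn n) 1,
    supportFun C (inner ℂ (u : Cn n) (v : Cn n)) ^ p * f v ∂(volume : Measure (Cn n)).toSphere

/-- The complex spherical Radon transform `(R_c f)(u) = ∫_{S^{2n-1} ∩ {v · u = 0}} f(v) dv`, with
respect to the spherical Lebesgue measure of the unit sphere of the complex hyperplane `u^⊥`. -/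
def complexSphericalRadon {n : ℕ}
    (f : C(Metric.sphere (0 : Cn n) 1, ℝ)) (u : Metric.sphere (0 : Cn n) 1) : ℝ :=
  sphereSectionIntegral (complexHyperplane (u : Cn n)) f

end

/-! Write `h` for the support function of `C` on `ℂ`. Since `⟨c u, x⟩ = ⟨c, x · u⟩`, the kernel of
`I_{C,p}` at `x` is `h (x · u) ^ p`, a function of one complex coordinate. Only three properties of
`h` matter: it is continuous, positively homogeneous of degree 1, and positive off the origin
(`IsGauge`).

In polar coordinates the mass of `h ^ p` on `{h ≤ a}` is `m a ^ (p + 2) / (p + 2)`, where `m = ∫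
h(v)⁻² dv` over the unit circle (`gaugeMass`). As `(p + 2) Γ(p + 2) = Γ(p + 3) → 1`, the kernels `h
^ p / Γ(p + 2)` have mass tending to `m` on every such set. Hence they concentrate at `0` and form
an approximate identity of mass `m` (`IsGauge.tendsto_integral`). Fubini on `ℂ u ⊕ u^⊥` turns `∫ h
(x · u) ^ p F(x) dx` into the integral over `ℂ` of `h ^ p` against the integrals of `F` over the
affine hyperplanes `z u + u^⊥`. For continuous, compactly supported `F` these are continuous at `z =
0` uniformly in `u`, so the limit is `m ∫_{u^⊥} F`, uniformly in `u`
(`IsGauge.tendstoUniformly_integral_rpow`).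

For (ii), `f` is extended off the sphere with a fixed radial profile. By homogeneity both sides
split into a spherical integral times a radial moment; at `p = -2` the two moments agree and cancel,
so `k' = m` (`IsGauge.tendstoUniformly_sphericalTransform`).

For (i), `∫_K h (x · u) ^ p dx` is `(2n + p)⁻¹` times the spherical transform of `ρ_K ^ (2n + p)`,
which tends uniformly to `ρ_K ^ (2n - 2)`. So the normalized integral tends to `m / (2n - 2)` times
the complex Radon transform of `ρ_K ^ (2n - 2)`. That transform does not change under averaging over
the circle, because `u^⊥` is a complex subspace. The limit is therefore `m V_{2n-2}(K^{S¹} ∩ u^⊥) =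
m π ρ(u)²`, with `ρ` the radial function of `I_c (K^{S¹})`. The exponent `-1 / p → 1 / 2` gives `k =
√(π m)`. -/

theorem lintegral_rpow_sub_one_Ioc {q b : ℝ} (hq : 0 < q) (hb : 0 ≤ b) :
    ∫⁻ r in Ioc 0 b, ENNReal.ofReal (r ^ (q - 1)) = ENNReal.ofReal (b ^ q / q) := by
  have hint : IntervalIntegrable (fun r : ℝ => r ^ (q - 1)) volume 0 b :=
    intervalIntegral.intervalIntegrable_rpow' (by linarith)
  rw [← ofReal_integral_eq_lintegral_ofReal hint.1, ← intervalIntegral.integral_of_le hb,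
    integral_rpow (Or.inl (by linarith))]
  · simp [hq.ne']
  · filter_upwards [ae_restrict_mem measurableSet_Ioc] with r hr
    exact Real.rpow_nonneg hr.1.le _

/-! ### Integration in polar coordinates. -/

section Polar

variable {E : Type*} [NormedAddCommGroup E] [NormedSpace ℝ E] [MeasurableSpace E] [BorelSpace E]
  [FiniteDimensional ℝ E] [Nontrivial E] (μ : Measure E) [μ.IsAddHaarMeasure]

local notation "dim" => Module.finrank ℝ

theorem lintegral_polar {f : E → ENNReal} (hf : Measurable f) :
    ∫⁻ x, f x ∂μ = ∫⁻ v : Metric.sphere (0 : E) 1, (∫⁻ r in Ioi (0 : ℝ),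
      ENNReal.ofReal (r ^ (dim E - 1)) * f (r • (v : E))) ∂μ.toSphere := by
  have hmp := μ.measurePreserving_homeomorphUnitSphereProd
  have hsymm := hmp.symm (homeomorphUnitSphereProd E).toMeasurableEquiv
  calc ∫⁻ x, f x ∂μ = ∫⁻ x : ({(0 : E)}ᶜ : Set E), f x ∂(μ.comap (↑)) := by
        rw [lintegral_subtype_comap (measurableSet_singleton _).compl f, restrict_compl_singleton]
    _ = ∫⁻ q, f ((homeomorphUnitSphereProd E).symm q)
          ∂(μ.toSphere.prod (Measure.volumeIoiPow (dim E - 1))) :=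
        (hsymm.lintegral_comp (hf.comp measurable_subtype_coe)).symm
    _ = ∫⁻ v : Metric.sphere (0 : E) 1, ∫⁻ r : Ioi (0 : ℝ), f ((r : ℝ) • (v : E))
          ∂(Measure.volumeIoiPow (dim E - 1)) ∂μ.toSphere := by
        rw [lintegral_prod _ (by fun_prop)]
        simp
    _ = _ := by
        refine lintegral_congr fun v => ?_
        have hfv : Measurable fun r : ℝ => f (r • (v : E)) := by fun_prop
        rw [Measure.volumeIoiPow, lintegral_withDensity_eq_lintegral_mul _ (by fun_prop)
          (by fun_prop), ← lintegral_subtype_comap measurableSet_Ioi]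
        rfl

/-- Integrability need not be assumed: the Bochner integral of a product of functions of separate
variables factors unconditionally. -/
theorem integral_polar_of_eq_mul {f : E → ℝ} {a : Metric.sphere (0 : E) 1 → ℝ} {b : ℝ → ℝ}
    (h : ∀ (v : Metric.sphere (0 : E) 1) (r : ℝ), 0 < r → f (r • (v : E)) = a v * b r) :
    ∫ x, f x ∂μ = (∫ v, a v ∂μ.toSphere) * ∫ r in Ioi (0 : ℝ), r ^ (dim E - 1) * b r := by
  have hmp := μ.measurePreserving_homeomorphUnitSphereProd
  have hsymm := hmp.symm (homeomorphUnitSphereProd E).toMeasurableEquiv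
  calc ∫ x, f x ∂μ = ∫ x : ({(0 : E)}ᶜ : Set E), f x ∂(μ.comap (↑)) := by
        rw [integral_subtype_comap (measurableSet_singleton _).compl f, restrict_compl_singleton]
    _ = ∫ q, f ((homeomorphUnitSphereProd E).symm q)
          ∂(μ.toSphere.prod (Measure.volumeIoiPow (dim E - 1))) :=
        (hsymm.integral_comp' (fun x : ({(0 : E)}ᶜ : Set E) => f x)).symm
    _ = ∫ q : Metric.sphere (0 : E) 1 × Ioi (0 : ℝ), a q.1 * b q.2
          ∂(μ.toSphere.prod (Measure.volumeIoiPow (dim E - 1))) := by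
        refine integral_congr_ae (Eventually.of_forall fun q => ?_)
        simpa using h q.1 q.2 q.2.2
    _ = (∫ v, a v ∂μ.toSphere) *
          ∫ r : Ioi (0 : ℝ), b r ∂(Measure.volumeIoiPow (dim E - 1)) :=
        integral_prod_mul a (fun r : Ioi (0 : ℝ) => b r)
    _ = _ := by
        congr 1
        simp only [Measure.volumeIoiPow, ENNReal.ofReal]
        rw [integral_withDensity_eq_integral_smul
          ((measurable_subtype_coe.pow_const _).real_toNNReal),
          integral_subtype_comap measurableSet_Ioi
            fun r => Real.toNNReal (r ^ (dim E - 1)) • b r]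
        refine setIntegral_congr_fun measurableSet_Ioi fun r hr => ?_
        simp only [NNReal.smul_def, smul_eq_mul]
        rw [Real.coe_toNNReal _ (pow_nonneg (le_of_lt hr) _)]

/-- Polar integration of `x ↦ a (x / ‖x‖) * ‖x‖ ^ p` over the points with `‖x‖ ≤ ρ (x / ‖x‖)`. -/
theorem lintegral_polar_of_eq_rpow {p : ℝ} (hp : 0 < dim E + p) {f : E → ENNReal}
    (hf : Measurable f) {a : Metric.sphere (0 : E) 1 → ENNReal}
    {ρ : Metric.sphere (0 : E) 1 → ℝ} (hρ : ∀ v, 0 ≤ ρ v)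
    (h : ∀ (v : Metric.sphere (0 : E) 1) (r : ℝ), 0 < r →
      f (r • (v : E)) = if r ≤ ρ v then a v * ENNReal.ofReal (r ^ p) else 0)
    (ha : ∀ v, a v ≠ ⊤) :
    ∫⁻ x, f x ∂μ =
      ∫⁻ v, a v * ENNReal.ofReal (ρ v ^ (dim E + p) / (dim E + p)) ∂μ.toSphere := by
  rw [lintegral_polar μ hf]
  refine lintegral_congr fun v => ?_
  rw [← lintegral_rpow_sub_one_Ioc hp (hρ v), ← lintegral_const_mul' _ _ (ha v),
    ← lintegral_indicator measurableSet_Ioi, ← lintegral_indicator measurableSet_Ioc]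
  refine lintegral_congr fun r => ?_
  by_cases hr : 0 < r
  · by_cases hrv : r ≤ ρ v
    · rw [indicator_of_mem (mem_Ioi.2 hr), indicator_of_mem (mem_Ioc.2 ⟨hr, hrv⟩), h v r hr,
        if_pos hrv, mul_left_comm, ← ENNReal.ofReal_mul (by positivity)]
      congr 2
      have hd : 1 ≤ dim E := Module.finrank_pos
      rw [← Real.rpow_natCast, ← Real.rpow_add hr]
      push_cast [hd]
      ring_nf
    · rw [indicator_of_mem (mem_Ioi.2 hr), indicator_of_notMem (fun hm => hrv hm.2), h v r hr,
        if_neg hrv, mul_zero]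
  · rw [indicator_of_notMem (show r ∉ Ioi (0 : ℝ) from hr), indicator_of_notMem (fun hm => hr hm.1)]

end Polar

/-! ### Extending functions from the sphere with a radial profile. -/

section PolarExt

variable {E : Type*} [NormedAddCommGroup E] [NormedSpace ℝ E]

open Classical in
/-- The function `x ↦ a (x / ‖x‖) * b ‖x‖`, set to `0` at the origin. -/
noncomputable def polarExt (a : Metric.sphere (0 : E) 1 → ℝ) (b : ℝ → ℝ) (x : E) : ℝ :=
  if hx : x = 0 then 0 else a ⟨‖x‖⁻¹ • x, by simp [norm_smul, hx]⟩ * b ‖x‖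

theorem polarExt_of_ne_zero (a : Metric.sphere (0 : E) 1 → ℝ) (b : ℝ → ℝ) {x : E} (hx : x ≠ 0) :
    polarExt a b x = a ⟨‖x‖⁻¹ • x, by simp [norm_smul, hx]⟩ * b ‖x‖ :=
  dif_neg hx

theorem polarExt_smul (a : Metric.sphere (0 : E) 1 → ℝ) (b : ℝ → ℝ) (v : Metric.sphere (0 : E) 1)
    {r : ℝ} (hr : 0 < r) : polarExt a b (r • (v : E)) = a v * b r := by
  have hv : ‖(v : E)‖ = 1 := by simp
  have hne : (v : E) ≠ 0 := fun h0 => by simp [h0] at hv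
  have hn : ‖r • (v : E)‖ = r := by rw [norm_smul, hv, mul_one, Real.norm_of_nonneg hr.le]
  rw [polarExt_of_ne_zero a b (smul_ne_zero hr.ne' hne)]
  congr 2
  · ext
    simp only [hn, smul_smul, inv_mul_cancel₀ hr.ne', one_smul]

theorem polarExt_eq_zero (a : Metric.sphere (0 : E) 1 → ℝ) {b : ℝ → ℝ} {x : E} (hb : b ‖x‖ = 0) :
    polarExt a b x = 0 := by
  by_cases hx : x = 0
  · exact dif_pos hx
  · rw [polarExt_of_ne_zero a b hx, hb, mul_zero]

/-- The direction `x / ‖x‖` is singular only at the origin, and a profile vanishing near `0` hides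
this singularity. -/
theorem continuous_polarExt {a : Metric.sphere (0 : E) 1 → ℝ} {b : ℝ → ℝ} (ha : Continuous a)
    (hb : Continuous b) {δ : ℝ} (hδ : 0 < δ) (hb0 : ∀ r, r ≤ δ → b r = 0) :
    Continuous (polarExt a b) := by
  refine continuous_iff_continuousAt.2 fun x => ?_
  by_cases hx : x = 0
  · have : polarExt a b =ᶠ[𝓝 x] fun _ => 0 := by
      filter_upwards [Metric.ball_mem_nhds x hδ] with y hy
      rw [hx, mem_ball_zero_iff] at hy
      exact polarExt_eq_zero a (hb0 _ hy.le)
    exact continuousAt_const.congr this.symm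
  · have hopen : IsOpen ({0}ᶜ : Set E) := isOpen_compl_singleton
    refine ContinuousOn.continuousAt ?_ (hopen.mem_nhds hx)
    rw [continuousOn_iff_continuous_domRestrict]
    have : ({0}ᶜ : Set E).domRestrict (polarExt a b) = fun x : ({0}ᶜ : Set E) =>
        a ⟨‖(x : E)‖⁻¹ • (x : E), by simp [norm_smul, show (x : E) ≠ 0 from x.2]⟩ * b ‖(x : E)‖ :=
      funext fun x => polarExt_of_ne_zero a b x.2
    rw [this]
    refine (ha.comp (Continuous.subtype_mk ?_ _)).mul (hb.comp (by fun_prop))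
    exact (Continuous.inv₀ (by fun_prop) fun x => norm_ne_zero_iff.2 x.2).smul (by fun_prop)

end PolarExt

/-! ### Isometries and subspaces in polar coordinates. -/

section Isometry

variable {E : Type*} [NormedAddCommGroup E] [InnerProductSpace ℝ E] [FiniteDimensional ℝ E]
  [MeasurableSpace E] [BorelSpace E]

/-- The spherical Lebesgue measure is invariant under linear isometries. -/
theorem integral_toSphere_comp_isometry [Nontrivial E] (e : E ≃ₗᵢ[ℝ] E)
    (a b : Metric.sphere (0 : E) 1 → ℝ)
    (h : ∀ v w : Metric.sphere (0 : E) 1, (w : E) = e v → b v = a w) :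
    ∫ v, b v ∂(volume : Measure E).toSphere = ∫ v, a v ∂(volume : Measure E).toSphere := by
  -- Any radial profile with nonzero moment would do: invariance of Lebesgue measure gives the claim
  -- times that moment, which is then cancelled.
  let φ : ℝ → ℝ := fun r => if r ≤ 1 then 1 else 0
  have hφ : ∫ r in Ioi (0 : ℝ), r ^ (Module.finrank ℝ E - 1) * φ r ≠ 0 := by
    have h1 : ∫ r in Ioi (0 : ℝ), r ^ (Module.finrank ℝ E - 1) * φ r =
        ∫ r in Ioc (0 : ℝ) 1, r ^ (Module.finrank ℝ E - 1) := by
      rw [← integral_indicator measurableSet_Ioi, ← integral_indicator measurableSet_Ioc]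
      congr 1
      ext r
      by_cases h0 : 0 < r <;> by_cases h1 : r ≤ 1 <;> simp [indicator, φ, h0, h1]
    rw [h1, ← intervalIntegral.integral_of_le zero_le_one, integral_pow]
    have : Module.finrank ℝ E - 1 + 1 ≠ 0 := by omega
    simp only [one_pow, ne_eq, this, not_false_eq_true, zero_pow, sub_zero]
    positivity
  have key : ∫ x, polarExt b φ x = ∫ x, polarExt a φ x := by
    rw [← e.measurePreserving.integral_comp e.toHomeomorph.measurableEmbedding (polarExt a φ)]
    refine integral_congr_ae (Eventually.of_forall fun x => ?_)
    by_cases hx : x = 0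
    · simp [polarExt, hx]
    · have hex : e x ≠ 0 := by simpa using hx
      simp only [polarExt_of_ne_zero _ _ hx, polarExt_of_ne_zero _ _ hex, e.norm_map]
      congr 1
      exact h _ _ (by simp)
  rw [integral_polar_of_eq_mul volume fun v _ => polarExt_smul a φ v,
    integral_polar_of_eq_mul volume fun v _ => polarExt_smul b φ v] at key
  exact mul_right_cancel₀ hφ key

/-- Polar coordinates on a subspace for functions that are given on the ambient space. -/
theorem integral_subspace_polarExt (W : Submodule ℝ E) [Nontrivial W]
    (f : Metric.sphere (0 : E) 1 → ℝ) (b : ℝ → ℝ) :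
    ∫ w : W, polarExt f b (w : E) =
      sphereSectionIntegral W f * ∫ r in Ioi (0 : ℝ), r ^ (Module.finrank ℝ W - 1) * b r :=
  integral_polar_of_eq_mul volume fun v _ hr =>
    polarExt_smul f b ⟨((v : W) : E), mem_sphere_zero_iff_norm.2 (mem_sphere_zero_iff_norm.1 v.2)⟩ hr

end Isometry

/-- On a compact space, uniform convergence to a continuous function is continuous convergence. -/
theorem tendstoUniformly_iff_forall_tendsto_nhds {ι X : Type*} [TopologicalSpace X]
    [CompactSpace X] {F : ι → X → ℝ} {f : X → ℝ} {l : Filter ι} (hf : Continuous f) :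
    TendstoUniformly F f l ↔
      ∀ x, Tendsto (fun q : ι × X => F q.1 q.2) (l ×ˢ 𝓝 x) (𝓝 (f x)) := by
  rw [← tendstoLocallyUniformly_iff_tendstoUniformly_of_compactSpace,
    tendstoLocallyUniformly_iff_forall_tendsto]
  refine forall_congr' fun x => ?_
  have hfx : Tendsto (fun q : ι × X => f q.2) (l ×ˢ 𝓝 x) (𝓝 (f x)) :=
    (hf.tendsto x).comp tendsto_snd
  constructor
  · intro h
    rw [Metric.uniformity_eq_comap_nhds_zero, tendsto_comap_iff] at h
    exact (hfx.congr_dist h)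
  · intro h
    rw [Metric.uniformity_eq_comap_nhds_zero, tendsto_comap_iff]
    simpa [Function.comp_def] using hfx.dist h

/-- Continuous, positively homogeneous functions on `ℂ` that are positive away from the origin. -/
structure IsGauge (h : ℂ → ℝ) : Prop where
  continuous : Continuous h
  map_smul : ∀ t : ℝ, 0 ≤ t → ∀ z, h (t • z) = t * h z
  pos : ∀ z, z ≠ 0 → 0 < h z

/-- Positivity is where the interior condition enters: `C` contains a small positive multiple of
`z`, whose inner product with `z` is positive. -/
theorem isGauge_supportFun (C : ConvexBody ℂ) (hC : (0 : ℂ) ∈ interior (C : Set ℂ)) :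
    IsGauge (supportFun (C : Set ℂ)) where
  continuous := by
    have : Continuous fun z : ℂ => sSup ((fun z a : ℂ => inner ℝ a z) z '' (C : Set ℂ)) :=
      C.isCompact.continuous_sSup (by fun_prop)
    exact this
  map_smul t ht z := by
    rw [supportFun, supportFun, ← smul_eq_mul, ← Real.sSup_smul_of_nonneg ht, ← image_smul,
      image_image]
    simp only [real_inner_smul_right, smul_eq_mul]
  pos z hz := by
    obtain ⟨δ, hδ, hsub⟩ := Metric.mem_nhds_iff.1 (mem_interior_iff_mem_nhds.1 hC)
    have hz' : 0 < ‖z‖ := norm_pos_iff.2 hz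
    have hmem : (δ / 2 / ‖z‖) • z ∈ (C : Set ℂ) := hsub (by
      rw [mem_ball_zero_iff, norm_smul, Real.norm_of_nonneg (by positivity)]
      field_simp
      linarith)
    have hbdd : BddAbove ((fun a : ℂ => inner ℝ a z) '' (C : Set ℂ)) :=
      (C.isCompact.image (by fun_prop)).bddAbove
    refine lt_of_lt_of_le ?_ (le_csSup hbdd (mem_image_of_mem _ hmem))
    rw [real_inner_smul_left, real_inner_self_eq_norm_sq]
    positivity

/-- `⟨c u, x⟩` is the real part of `conj c * (x · u)`, which is the real inner product of `c` and `x
· u` in `ℂ`. This reduces the kernel to one complex variable. -/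
theorem supportFun_bodyMul {n : ℕ} (C : Set ℂ) (u x : Cn n) :
    supportFun (bodyMul C u) x = supportFun C (inner ℂ u x) := by
  rw [supportFun, supportFun, bodyMul, image_image]
  congr 1
  refine image_congr fun c _ => ?_
  have h1 : inner ℝ (c • u) x = (inner ℂ (c • u) x).re := by
    simp only [PiLp.inner_apply, Complex.re_sum]
    exact Finset.sum_congr rfl fun i _ => by rw [Complex.inner, RCLike.inner_apply]
  rw [h1, inner_smul_left, Complex.inner, mul_comm]

/-! ### Comparison of a gauge with the norm, by compactness of the unit circle. -/

namespace IsGauge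

variable {h : ℂ → ℝ}

theorem map_zero (hh : IsGauge h) : h 0 = 0 := by
  simpa using hh.map_smul 0 le_rfl 0

theorem nonneg (hh : IsGauge h) (z : ℂ) : 0 ≤ h z := by
  by_cases hz : z = 0
  · rw [hz, hh.map_zero]
  · exact (hh.pos z hz).le

theorem exists_le_norm (hh : IsGauge h) : ∃ R, 0 < R ∧ ∀ z, h z ≤ R * ‖z‖ := by
  obtain ⟨R, hR⟩ := (isCompact_sphere (0 : ℂ) 1).bddAbove_image hh.continuous.continuousOn
  refine ⟨max R 1, by positivity, fun z => ?_⟩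
  by_cases hz : z = 0
  · simp [hz, hh.map_zero]
  · have hz' : 0 < ‖z‖ := norm_pos_iff.2 hz
    have h1 : h (‖z‖⁻¹ • z) ≤ R := hR (mem_image_of_mem _ (by simp [hz]))
    rw [hh.map_smul _ (by positivity), inv_mul_le_iff₀ hz'] at h1
    calc h z ≤ ‖z‖ * R := h1
      _ ≤ max R 1 * ‖z‖ := by rw [mul_comm]; gcongr; exact le_max_left _ _

theorem exists_norm_le (hh : IsGauge h) : ∃ R, 0 < R ∧ ∀ z, ‖z‖ ≤ R * h z := by
  obtain ⟨z₀, hz₀, hmin⟩ := (isCompact_sphere (0 : ℂ) 1).exists_isMinOn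
    (NormedSpace.sphere_nonempty.2 zero_le_one) hh.continuous.continuousOn
  have h0 : 0 < h z₀ := hh.pos _ fun h0 => by simp [h0] at hz₀
  refine ⟨(h z₀)⁻¹, by positivity, fun z => ?_⟩
  by_cases hz : z = 0
  · simp [hz, hh.map_zero]
  · have hz' : 0 < ‖z‖ := norm_pos_iff.2 hz
    have h1 : h z₀ ≤ h (‖z‖⁻¹ • z) := hmin (by simp [hz])
    rw [hh.map_smul _ (by positivity)] at h1
    field_simp at h1 ⊢
    exact h1

theorem pos_sphere (hh : IsGauge h) (v : Metric.sphere (0 : ℂ) 1) : 0 < h v :=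
  hh.pos _ fun h0 => by simpa [h0] using v.2

end IsGauge

/-- The mass `∫ h(v)⁻² dv` over the unit circle. -/
noncomputable def gaugeMass (h : ℂ → ℝ) : ℝ :=
  ∫ v : Metric.sphere (0 : ℂ) 1, h v ^ (-2 : ℝ) ∂(volume : Measure ℂ).toSphere

/-! ### The kernels `h ^ p` as an approximate identity on `ℂ`. -/

namespace IsGauge

variable {h : ℂ → ℝ}

theorem continuous_rpow_sphere (hh : IsGauge h) (p : ℝ) :
    Continuous fun v : Metric.sphere (0 : ℂ) 1 => h v ^ p :=
  (hh.continuous.comp continuous_subtype_val).rpow_const fun v => Or.inl (hh.pos_sphere v).ne'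

theorem gaugeMass_pos (hh : IsGauge h) : 0 < gaugeMass h := by
  have hc := hh.continuous_rpow_sphere (-2)
  refine (hc.integral_pos_of_hasCompactSupport_nonneg_nonzero
    (HasCompactSupport.of_compactSpace _) (fun v => Real.rpow_nonneg (hh.nonneg _) _)
    (x := ⟨1, by simp⟩) ?_)
  exact (Real.rpow_pos_of_pos (hh.pos_sphere _) _).ne'

theorem measurable_rpow (hh : IsGauge h) (p : ℝ) : Measurable fun z => h z ^ p :=
  hh.continuous.measurable.pow_const p

/-- In the direction `v` the radius runs up to `a / h v`, contributing `h(v) ^ p (a / h v) ^ (p + 2)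
/ (p + 2)`. The powers of `h v` combine to `h(v)⁻²`, so the angular factor does not depend on `p`.
-/
theorem lintegral_rpow (hh : IsGauge h) {p a : ℝ} (hp : -2 < p) (ha : 0 ≤ a) :
    ∫⁻ z in {z | h z ≤ a}, ENNReal.ofReal (h z ^ p) =
      ENNReal.ofReal (gaugeMass h * a ^ (p + 2) / (p + 2)) := by
  have hms : MeasurableSet {z | h z ≤ a} := measurableSet_le hh.continuous.measurable
    measurable_const
  have hfr : Module.finrank ℝ ℂ = 2 := Complex.finrank_real_complex
  have hp2 : 0 < p + 2 := by linarith
  rw [← lintegral_indicator hms, lintegral_polar_of_eq_rpow (p := p) volume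
    (a := fun v => ENNReal.ofReal (h v ^ p)) (ρ := fun v => a / h v)]
  · rw [hfr, gaugeMass, mul_div_assoc, mul_comm, ENNReal.ofReal_mul (by positivity),
      ofReal_integral_eq_lintegral_ofReal, ← lintegral_const_mul']
    · refine lintegral_congr fun v => ?_
      have hv := hh.pos_sphere v
      rw [← ENNReal.ofReal_mul (by positivity), ← ENNReal.ofReal_mul (by positivity)]
      congr 1
      push_cast
      rw [Real.div_rpow ha hv.le, Real.rpow_neg hv.le, Real.rpow_add hv]
      have : 0 < h v ^ p := by positivity
      rw [add_comm 2 p]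
      field_simp
    · exact ENNReal.ofReal_ne_top
    · exact (hh.continuous_rpow_sphere _).integrable_of_hasCompactSupport
        (HasCompactSupport.of_compactSpace _)
    · exact Eventually.of_forall fun v => Real.rpow_nonneg (hh.nonneg _) _
  · rw [hfr]; push_cast; linarith
  · exact (hh.measurable_rpow p).ennreal_ofReal.indicator hms
  · exact fun v => div_nonneg ha (hh.nonneg _)
  · intro v r hr
    have hv := hh.pos_sphere v
    simp only [indicator, mem_ofPred_eq, hh.map_smul r hr.le, le_div_iff₀ hv]
    split_ifs with hle
    · rw [← ENNReal.ofReal_mul (by positivity), mul_comm r, Real.mul_rpow hv.le hr.le]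
    · rfl
  · exact fun v => ENNReal.ofReal_ne_top

theorem integrableOn_rpow (hh : IsGauge h) {p : ℝ} (hp : -2 < p) (a : ℝ) :
    IntegrableOn (fun z => h z ^ p) {z | h z ≤ a} := by
  have hle : IntegrableOn (fun z => h z ^ p) {z | h z ≤ max a 0} := by
    refine ⟨(hh.measurable_rpow p).aestronglyMeasurable, ?_⟩
    rw [hasFiniteIntegral_iff_ofReal
      (Eventually.of_forall fun z => Real.rpow_nonneg (hh.nonneg _) _),
      hh.lintegral_rpow hp (le_max_right _ _)]
    exact ENNReal.ofReal_lt_top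
  exact hle.mono_set fun z (hz : h z ≤ a) => hz.trans (le_max_left a 0)

theorem setIntegral_rpow (hh : IsGauge h) {p a : ℝ} (hp : -2 < p) (ha : 0 ≤ a) :
    ∫ z in {z | h z ≤ a}, h z ^ p = gaugeMass h * a ^ (p + 2) / (p + 2) := by
  have hp2 : 0 < p + 2 := by linarith
  have := hh.gaugeMass_pos
  rw [integral_eq_lintegral_of_nonneg_ae
    (Eventually.of_forall fun z => Real.rpow_nonneg (hh.nonneg _) _)
    (hh.measurable_rpow p).aestronglyMeasurable, hh.lintegral_rpow hp ha,
    ENNReal.toReal_ofReal (by positivity)]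

/-- The pole of `1 / (p + 2)` is cancelled by `(p + 2) Γ(p + 2) = Γ(p + 3) → Γ(1) = 1`. The limit
does not depend on `a`, so no mass survives away from the origin. -/
theorem tendsto_mass {ι : Type*} {l : Filter ι} {p : ι → ℝ} (hp : Tendsto p l (𝓝[>] (-2)))
    (hh : IsGauge h) {a : ℝ} (ha : 0 < a) :
    Tendsto (fun i => 1 / Real.Gamma (p i + 2) * ∫ z in {z | h z ≤ a}, h z ^ p i) l
      (𝓝 (gaugeMass h)) := by
  have hp' : ∀ᶠ i in l, -2 < p i := hp self_mem_nhdsWithin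
  have hp0 : Tendsto p l (𝓝 (-2)) := hp.mono_right nhdsWithin_le_nhds
  have key : Tendsto (fun i => gaugeMass h * a ^ (p i + 2) / Real.Gamma (p i + 3)) l
      (𝓝 (gaugeMass h * a ^ (-2 + 2 : ℝ) / Real.Gamma (-2 + 3))) := by
    refine Tendsto.div (tendsto_const_nhds.mul ?_) ?_ ?_
    · exact ((Real.continuousAt_const_rpow ha.ne').tendsto).comp (hp0.add_const 2)
    · refine (ContinuousAt.tendsto (Real.differentiableAt_Gamma fun m => ?_).continuousAt).comp
        (hp0.add_const 3)
      have : (0 : ℝ) ≤ m := m.cast_nonneg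
      linarith
    · exact (Real.Gamma_pos_of_pos (by norm_num)).ne'
  have h1 : Real.Gamma (-2 + 3) = 1 := by norm_num
  rw [h1] at key
  simp only [neg_add_cancel, Real.rpow_zero, mul_one, div_one] at key
  refine key.congr' ?_
  filter_upwards [hp'] with i hi
  have h2 : 0 < p i + 2 := by linarith
  have h3 := Real.Gamma_pos_of_pos h2
  rw [hh.setIntegral_rpow hi ha.le, show p i + 3 = p i + 2 + 1 by ring, Real.Gamma_add_one h2.ne']
  field_simp

/-- As `p → -2`, the kernels `h ^ p / Γ(p + 2)` form an approximate identity at the origin. -/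
theorem tendsto_integral {ι : Type*} {l : Filter ι} {p : ι → ℝ}
    (hp : Tendsto p l (𝓝[>] (-2))) (hh : IsGauge h) {G : ι → ℂ → ℝ} {M R : ℝ}
    (hM : ∀ i z, |G i z| ≤ M) (hR : ∀ i z, R < h z → G i z = 0)
    (hmeas : ∀ i, AEStronglyMeasurable (G i) volume)
    (h0 : Tendsto (fun q : ι × ℂ => G q.1 q.2 - G q.1 0) (l ×ˢ 𝓝 0) (𝓝 0)) :
    Tendsto (fun i => 1 / Real.Gamma (p i + 2) * (∫ z, h z ^ p i * G i z) -
      gaugeMass h * G i 0) l (𝓝 0) := by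
  rcases l.eq_or_neBot with rfl | hl
  · exact tendsto_bot
  have hp' : ∀ᶠ i in l, -2 < p i := hp self_mem_nhdsWithin
  have hM0 : 0 ≤ M := by
    obtain ⟨i⟩ : Nonempty ι := nonempty_of_neBot l
    exact (abs_nonneg _).trans (hM i 0)
  have hmass := hh.gaugeMass_pos
  set R' := max R 1 with hR'
  have hR'0 : 0 < R' := by positivity
  let A (a : ℝ) (i : ι) : ℝ := 1 / Real.Gamma (p i + 2) * ∫ z in {z | h z ≤ a}, h z ^ p i
  have hms (a : ℝ) : MeasurableSet {z | h z ≤ a} :=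
    measurableSet_le hh.continuous.measurable measurable_const
  have hA {a : ℝ} (ha : 0 < a) : Tendsto (A a) l (𝓝 (gaugeMass h)) := tendsto_mass hp hh ha
  -- Splitting `G i z = G i 0 + (G i z - G i 0)` separates the error of the total mass from the
  -- oscillation of `G i` at the origin.
  have hsplit : ∀ᶠ i in l, 1 / Real.Gamma (p i + 2) * (∫ z, h z ^ p i * G i z) -
      gaugeMass h * G i 0 = 1 / Real.Gamma (p i + 2) *
        (∫ z in {z | h z ≤ R'}, h z ^ p i * (G i z - G i 0)) + (A R' i - gaugeMass h) * G i 0 := by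
    filter_upwards [hp'] with i hi
    have hint := hh.integrableOn_rpow hi R'
    have hint' : IntegrableOn (fun z => h z ^ p i * G i z) {z | h z ≤ R'} :=
      hint.mul_bdd (c := M) (hmeas i).restrict (Eventually.of_forall (hM i))
    have e1 : ∫ z, h z ^ p i * G i z = ∫ z in {z | h z ≤ R'}, h z ^ p i * G i z := by
      rw [setIntegral_eq_integral_of_forall_compl_eq_zero]
      intro z hz
      rw [hR i z (lt_of_le_of_lt (le_max_left _ _) (not_le.1 hz)), mul_zero]
    have e2 : ∫ z in {z | h z ≤ R'}, h z ^ p i * (G i z - G i 0) =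
        (∫ z in {z | h z ≤ R'}, h z ^ p i * G i z) -
          (∫ z in {z | h z ≤ R'}, h z ^ p i) * G i 0 := by
      simp only [mul_sub]
      rw [integral_sub hint' (hint.mul_const _), integral_mul_const]
    rw [e1, e2]
    simp only [A]
    ring
  refine Tendsto.congr' (EventuallyEq.symm hsplit) ?_
  rw [← add_zero (0 : ℝ)]
  refine Tendsto.add ?_ ?_
  · rw [Metric.tendsto_nhds]
    intro ε hε
    set η := ε / (2 * gaugeMass h) with hη
    have hη0 : 0 < η := by positivity
    have hev : ∀ᶠ q : ι × ℂ in l ×ˢ 𝓝 0, |G q.1 q.2 - G q.1 0| < η := by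
      simpa [Real.dist_eq] using Metric.tendsto_nhds.1 h0 η hη0
    obtain ⟨P, hP, Q, hQ, hPQ⟩ := eventually_prod_iff.1 hev
    obtain ⟨δ', hδ', hball⟩ := Metric.eventually_nhds_iff.1 hQ
    obtain ⟨B, hB, hBle⟩ := hh.exists_norm_le
    set δ := min (δ' / (2 * B)) R' with hδ
    have hδ0 : 0 < δ := by positivity
    have hQδ (z : ℂ) (hz : h z ≤ δ) : Q z := by
      refine hball ?_
      rw [dist_zero_right]
      calc ‖z‖ ≤ B * h z := hBle z
        _ ≤ B * (δ' / (2 * B)) := by gcongr; exact hz.trans (min_le_left _ _)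
        _ = δ' / 2 := by field_simp
        _ < δ' := by linarith
    -- On `{h ≤ δ}` the oscillation is below `η`. On `{δ < h ≤ R'}` it is at most `2 M`, but the
    -- mass there is a difference of two quantities with the same limit. The limit of this bound is
    -- `η * gaugeMass h = ε / 2`.
    have hlim : Tendsto (fun i => η * A δ i + 2 * M * (A R' i - A δ i)) l
        (𝓝 (η * gaugeMass h + 2 * M * (gaugeMass h - gaugeMass h))) :=
      ((hA hδ0).const_mul η).add (((hA hR'0).sub (hA hδ0)).const_mul (2 * M))
    have hlt : η * gaugeMass h + 2 * M * (gaugeMass h - gaugeMass h) < ε := by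
      rw [sub_self, mul_zero, add_zero, hη]
      field_simp
      linarith
    filter_upwards [hp', hP, hlim.eventually_lt_const hlt] with i hi hPi hlti
    rw [Real.dist_eq, sub_zero]
    refine lt_of_le_of_lt ?_ hlti
    have hΓ := Real.Gamma_pos_of_pos (show 0 < p i + 2 by linarith)
    have hsub : {z | h z ≤ δ} ⊆ {z | h z ≤ R'} := fun z (hz : h z ≤ δ) => hz.trans (min_le_right _ R')
    have hint := hh.integrableOn_rpow hi R'
    have hindδ : IntegrableOn ({z | h z ≤ δ}.indicator fun z => h z ^ p i) {z | h z ≤ R'} :=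
      hint.indicator (hms δ)
    have eδ : ∫ z in {z | h z ≤ R'}, {z | h z ≤ δ}.indicator (fun z => h z ^ p i) z =
        ∫ z in {z | h z ≤ δ}, h z ^ p i := by
      rw [setIntegral_indicator (hms δ), inter_eq_self_of_subset_right hsub]
    have hdiff : IntegrableOn (fun z => h z ^ p i - {z | h z ≤ δ}.indicator (fun z => h z ^ p i) z)
        {z | h z ≤ R'} := hint.sub hindδ
    have hbound : |∫ z in {z | h z ≤ R'}, h z ^ p i * (G i z - G i 0)| ≤
        ∫ z in {z | h z ≤ R'}, (η * {z | h z ≤ δ}.indicator (fun z => h z ^ p i) z +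
          2 * M * (h z ^ p i - {z | h z ≤ δ}.indicator (fun z => h z ^ p i) z)) := by
      rw [← Real.norm_eq_abs]
      refine norm_integral_le_of_norm_le (μ := volume.restrict {z | h z ≤ R'})
        ((hindδ.const_mul η).add (hdiff.const_mul (2 * M))) (Eventually.of_forall fun z => ?_)
      have hz0 := Real.rpow_nonneg (hh.nonneg z) (p i)
      rw [Real.norm_eq_abs, abs_mul, abs_of_nonneg hz0]
      by_cases hz : h z ≤ δ
      · rw [indicator_of_mem (show z ∈ {z | h z ≤ δ} from hz), sub_self, mul_zero, add_zero,
          mul_comm]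
        gcongr
        exact (hPQ hPi (hQδ z hz)).le
      · rw [indicator_of_notMem (show z ∉ {z | h z ≤ δ} from hz), mul_zero, sub_zero, zero_add,
          mul_comm]
        gcongr
        calc |G i z - G i 0| ≤ |G i z| + |G i 0| := abs_sub _ _
          _ ≤ 2 * M := by linarith [hM i z, hM i 0]
    have hR : ∫ z in {z | h z ≤ R'}, (η * {z | h z ≤ δ}.indicator (fun z => h z ^ p i) z +
          2 * M * (h z ^ p i - {z | h z ≤ δ}.indicator (fun z => h z ^ p i) z)) =
        η * (∫ z in {z | h z ≤ δ}, h z ^ p i) + 2 * M * ((∫ z in {z | h z ≤ R'}, h z ^ p i) -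
          ∫ z in {z | h z ≤ δ}, h z ^ p i) := by
      rw [integral_add (hindδ.const_mul η) (hdiff.const_mul (2 * M)),
        integral_const_mul, integral_const_mul, integral_sub hint hindδ, eδ]
    rw [abs_mul, abs_of_pos (by positivity : 0 < 1 / Real.Gamma (p i + 2))]
    refine (mul_le_mul_of_nonneg_left (hbound.trans_eq hR) (by positivity)).trans_eq ?_
    simp only [A]
    ring
  · have hbdd : IsBoundedUnder (· ≤ ·) l (norm ∘ fun i => G i 0) :=
      isBoundedUnder_of ⟨M, fun i => hM i 0⟩
    refine Tendsto.zero_mul_isBoundedUnder_le ?_ hbdd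
    simpa using (hA hR'0).sub_const (gaugeMass h)

end IsGauge

/-! ### Splitting a Euclidean space as `ℂ ⊕ W`. -/

section OrthogonalSum

variable {E : Type*} [NormedAddCommGroup E] [InnerProductSpace ℝ E]
  {W : Submodule ℝ E} {j : ℂ →ₗᵢ[ℝ] E}

theorem norm_sq_isometry_add (horth : ∀ z, ∀ w ∈ W, inner ℝ (j z) w = 0) (z : ℂ) (w : W) :
    ‖j z + (w : E)‖ ^ 2 = ‖z‖ ^ 2 + ‖w‖ ^ 2 := by
  have h := norm_add_sq_eq_norm_sq_add_norm_sq_real (horth z w w.2)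
  rw [j.norm_map] at h
  rw [sq, h, sq, sq]
  rfl

/-- The orthogonal decomposition of a Euclidean space into an isometric copy of `ℂ` and a subspace
`W`. -/
noncomputable def orthogonalSumEquiv (horth : ∀ z, ∀ w ∈ W, inner ℝ (j z) w = 0)
    (hsum : ∀ x, ∃ z, x - j z ∈ W) : WithLp 2 (ℂ × W) ≃ₗᵢ[ℝ] E :=
  LinearIsometryEquiv.ofSurjective
    { toFun := fun q => j q.fst + (q.snd : E)
      map_add' := fun q q' => by
        simp only [WithLp.add_fst, WithLp.add_snd, Submodule.coe_add, map_add]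
        abel
      map_smul' := fun t q => by
        simp only [WithLp.smul_fst, WithLp.smul_snd, Submodule.coe_smul, smul_add,
          map_smul, RingHom.id_apply]
      norm_map' := fun q => by
        rw [← sq_eq_sq₀ (norm_nonneg _) (norm_nonneg _), WithLp.prod_norm_sq_eq_of_L2]
        exact norm_sq_isometry_add horth q.fst q.snd }
    (fun x => by
      obtain ⟨z, hz⟩ := hsum x
      exact ⟨WithLp.toLp 2 (z, ⟨_, hz⟩), by simp⟩)

variable [FiniteDimensional ℝ E]

theorem finrank_add_two (horth : ∀ z, ∀ w ∈ W, inner ℝ (j z) w = 0)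
    (hsum : ∀ x, ∃ z, x - j z ∈ W) : Module.finrank ℝ W + 2 = Module.finrank ℝ E := by
  rw [← (orthogonalSumEquiv horth hsum).toLinearEquiv.finrank_eq,
    (WithLp.linearEquiv 2 ℝ (ℂ × W)).finrank_eq, Module.finrank_prod,
    Complex.finrank_real_complex, add_comm]

variable [MeasurableSpace E] [BorelSpace E]

/-- Lebesgue measure on a subspace of a Euclidean space. -/
noncomputable abbrev subspaceVolume (W : Submodule ℝ E) : Measure W :=
  volume

theorem measurePreserving_isometry_add (horth : ∀ z, ∀ w ∈ W, inner ℝ (j z) w = 0)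
    (hsum : ∀ x, ∃ z, x - j z ∈ W) :
    MeasurePreserving (fun q : ℂ × W => j q.1 + (q.2 : E))
      ((volume : Measure ℂ).prod (subspaceVolume W)) volume :=
  (orthogonalSumEquiv horth hsum).measurePreserving.comp (WithLp.volume_preserving_toLp ℂ W)

theorem measurableEmbedding_isometry_add (horth : ∀ z, ∀ w ∈ W, inner ℝ (j z) w = 0)
    (hsum : ∀ x, ∃ z, x - j z ∈ W) :
    MeasurableEmbedding (fun q : ℂ × W => j q.1 + (q.2 : E)) :=
  (orthogonalSumEquiv horth hsum).toHomeomorph.measurableEmbedding.comp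
    (MeasurableEquiv.toLp 2 (ℂ × W)).measurableEmbedding

theorem subspaceVolume_closedBall {W' : Submodule ℝ E}
    (h : Module.finrank ℝ W = Module.finrank ℝ W') (R : ℝ) :
    subspaceVolume W (Metric.closedBall 0 R) = subspaceVolume W' (Metric.closedBall 0 R) := by
  let e : W ≃ₗᵢ[ℝ] W' := (stdOrthonormalBasis ℝ W).equiv (stdOrthonormalBasis ℝ W') (finCongr h)
  rw [← e.measurePreserving.measure_preimage
    (Metric.isClosed_closedBall (x := (0 : W')) (ε := R)).nullMeasurableSet,
    e.preimage_closedBall, map_zero]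

end OrthogonalSum

/-! ### Fubini along complex hyperplanes. -/

section Decomposition

variable {n : ℕ}

theorem inner_smul_add_complexHyperplane {u : Cn n} (hu : ‖u‖ = 1) (z : ℂ)
    (w : complexHyperplane u) : inner ℂ u (z • u + (w : Cn n)) = z := by
  have hw : inner ℂ u (w : Cn n) = 0 :=
    Submodule.mem_orthogonal_singleton_iff_inner_right.1 w.2
  rw [inner_add_right, hw, inner_smul_right, inner_self_eq_norm_sq_to_K, hu]
  simp

/-- The isometric embedding `z ↦ z u` of `ℂ` for a unit vector `u`. -/
noncomputable def complexLineIsometry {u : Cn n} (hu : ‖u‖ = 1) : ℂ →ₗᵢ[ℝ] Cn n where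
  toFun z := z • u
  map_add' z z' := add_smul z z' u
  map_smul' t z := smul_assoc t z u
  norm_map' z := by
    change ‖z • u‖ = ‖z‖
    rw [norm_smul, hu, mul_one]

theorem real_inner_Cn (x y : Cn n) : inner ℝ x y = (inner ℂ x y).re := by
  simp only [PiLp.inner_apply, Complex.re_sum]
  exact Finset.sum_congr rfl fun i _ => by rw [Complex.inner, RCLike.inner_apply]

theorem inner_complexLineIsometry {u : Cn n} (hu : ‖u‖ = 1) (z : ℂ) (w : Cn n)
    (hw : w ∈ complexHyperplane u) : inner ℝ (complexLineIsometry hu z) w = 0 := by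
  have hw : inner ℂ u w = 0 := Submodule.mem_orthogonal_singleton_iff_inner_right.1 hw
  change inner ℝ (z • u) w = 0
  rw [real_inner_Cn, inner_smul_left, hw, mul_zero, Complex.zero_re]

theorem exists_sub_complexLineIsometry_mem {u : Cn n} (hu : ‖u‖ = 1) (x : Cn n) :
    ∃ z, x - complexLineIsometry hu z ∈ complexHyperplane u := by
  refine ⟨inner ℂ u x, Submodule.mem_orthogonal_singleton_iff_inner_right.2 ?_⟩
  change inner ℂ u (x - (inner ℂ u x : ℂ) • u) = 0
  rw [inner_sub_right, inner_smul_right, inner_self_eq_norm_sq_to_K, hu]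
  simp

theorem norm_sq_smul_add_complexHyperplane {u : Cn n} (hu : ‖u‖ = 1) (z : ℂ)
    (w : complexHyperplane u) : ‖z • u + (w : Cn n)‖ ^ 2 = ‖z‖ ^ 2 + ‖w‖ ^ 2 :=
  norm_sq_isometry_add (inner_complexLineIsometry hu) z w

theorem measurePreserving_smul_add {u : Cn n} (hu : ‖u‖ = 1) :
    MeasurePreserving (fun q : ℂ × complexHyperplane u => q.1 • u + (q.2 : Cn n))
      ((volume : Measure ℂ).prod (subspaceVolume (complexHyperplane u))) volume :=
  measurePreserving_isometry_add (inner_complexLineIsometry hu)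
    (exists_sub_complexLineIsometry_mem hu)

theorem measurableEmbedding_smul_add {u : Cn n} (hu : ‖u‖ = 1) :
    MeasurableEmbedding (fun q : ℂ × complexHyperplane u => q.1 • u + (q.2 : Cn n)) :=
  measurableEmbedding_isometry_add (inner_complexLineIsometry hu)
    (exists_sub_complexLineIsometry_mem hu)

theorem finrank_Cn : Module.finrank ℝ (Cn n) = 2 * n := by
  rw [← Module.finrank_mul_finrank ℝ ℂ (Cn n), Complex.finrank_real_complex,
    finrank_euclideanSpace_fin]

theorem finrank_complexHyperplane {u : Cn n} (hu : ‖u‖ = 1) :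
    Module.finrank ℝ (complexHyperplane u) + 2 = 2 * n :=
  (finrank_add_two (inner_complexLineIsometry hu)
    (exists_sub_complexLineIsometry_mem hu)).trans finrank_Cn

/-- The volume of the ball of radius `R` in a complex hyperplane is bounded uniformly. -/
theorem exists_volume_closedBall_le (n : ℕ) (R : ℝ) : ∃ V : ℝ, 0 ≤ V ∧ ∀ u : Cn n, ‖u‖ = 1 →
    (subspaceVolume (complexHyperplane u)).real (Metric.closedBall 0 R) ≤ V := by
  by_cases h : ∃ u₀ : Cn n, ‖u₀‖ = 1
  · obtain ⟨u₀, hu₀⟩ := h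
    refine ⟨(subspaceVolume (complexHyperplane u₀)).real (Metric.closedBall 0 R),
      measureReal_nonneg, fun u hu => le_of_eq ?_⟩
    have hfr : Module.finrank ℝ (complexHyperplane u) =
        Module.finrank ℝ (complexHyperplane u₀) := by
      have := finrank_complexHyperplane hu
      have := finrank_complexHyperplane hu₀
      omega
    exact congrArg ENNReal.toReal (subspaceVolume_closedBall hfr R)
  · exact ⟨0, le_rfl, fun u hu => absurd ⟨u, hu⟩ h⟩

/-- The integral of `F` over the affine complex hyperplane `z u + u^⊥`. -/
noncomputable def hyperplaneIntegral (u : Cn n) (F : Cn n → ℝ) (z : ℂ) : ℝ :=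
  ∫ w, F (z • u + (w : Cn n)) ∂(subspaceVolume (complexHyperplane u))

variable {F : Cn n → ℝ} {M R : ℝ}

theorem norm_le_norm_smul_add {u : Cn n} (hu : ‖u‖ = 1) (z : ℂ) (w : complexHyperplane u) :
    ‖z‖ ≤ ‖z • u + (w : Cn n)‖ ∧ ‖w‖ ≤ ‖z • u + (w : Cn n)‖ := by
  have h := norm_sq_smul_add_complexHyperplane hu z w
  constructor <;> refine le_of_sq_le_sq ?_ (norm_nonneg _) <;> nlinarith [sq_nonneg ‖z‖, sq_nonneg ‖w‖]

theorem hyperplaneIntegral_eq_zero {u : Cn n} (hu : ‖u‖ = 1) (hR : ∀ x, R < ‖x‖ → F x = 0)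
    {z : ℂ} (hz : R < ‖z‖) : hyperplaneIntegral u F z = 0 := by
  refine integral_eq_zero_of_ae (Eventually.of_forall fun w => ?_)
  exact hR _ (hz.trans_le (norm_le_norm_smul_add hu z w).1)

theorem abs_hyperplaneIntegral_le {V : ℝ} {u : Cn n} (hu : ‖u‖ = 1)
    (hV : (subspaceVolume (complexHyperplane u)).real (Metric.closedBall 0 R) ≤ V)
    (hM : ∀ x, |F x| ≤ M) (hR : ∀ x, R < ‖x‖ → F x = 0) (z : ℂ) :
    |hyperplaneIntegral u F z| ≤ M * V := by
  have hM0 : 0 ≤ M := (abs_nonneg _).trans (hM 0)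
  have h1 : hyperplaneIntegral u F z =
      ∫ w in Metric.closedBall (0 : complexHyperplane u) R, F (z • u + (w : Cn n)) := by
    refine (setIntegral_eq_integral_of_forall_compl_eq_zero fun w hw => ?_).symm
    rw [mem_closedBall_zero_iff, not_le] at hw
    exact hR _ (hw.trans_le (norm_le_norm_smul_add hu z w).2)
  rw [h1, ← Real.norm_eq_abs]
  refine (norm_setIntegral_le_of_norm_le_const measure_closedBall_lt_top
    fun w _ => hM _).trans ?_
  gcongr

theorem stronglyMeasurable_hyperplaneIntegral (hF : Measurable F) (u : Cn n) :
    StronglyMeasurable (hyperplaneIntegral u F) := by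
  have : StronglyMeasurable fun q : ℂ × complexHyperplane u => F (q.1 • u + (q.2 : Cn n)) :=
    Measurable.stronglyMeasurable (hF.comp (by fun_prop))
  exact this.integral_prod_right

/-- Local integrability of `k` suffices: as `F` lives on a ball, both `z` and `w` are confined to
balls of the same radius, and the integrand is a bounded multiple of a product of integrable
functions. -/
theorem integrable_smul_add {k : ℂ → ℝ}
    (hkint : IntegrableOn k (Metric.closedBall 0 R)) {u : Cn n} (hu : ‖u‖ = 1) (hF : Measurable F)
    (hM : ∀ x, |F x| ≤ M) (hR : ∀ x, R < ‖x‖ → F x = 0) :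
    Integrable (fun q : ℂ × complexHyperplane u => k q.1 * F (q.1 • u + (q.2 : Cn n)))
      ((volume : Measure ℂ).prod (subspaceVolume (complexHyperplane u))) := by
  have h1 : Integrable ((Metric.closedBall (0 : ℂ) R).indicator k) :=
    (integrable_indicator_iff measurableSet_closedBall).2 hkint
  have h2 : Integrable ((Metric.closedBall (0 : complexHyperplane u) R).indicator
      fun _ => (1 : ℝ)) :=
    (integrable_indicator_iff measurableSet_closedBall).2
      (integrableOn_const measure_closedBall_lt_top.ne)
  have hFm : Measurable fun q : ℂ × complexHyperplane u => F (q.1 • u + (q.2 : Cn n)) :=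
    hF.comp (by fun_prop)
  refine ((h1.mul_prod h2).mul_bdd (c := M) hFm.aestronglyMeasurable
    (Eventually.of_forall fun q => hM _)).congr (Eventually.of_forall fun q => ?_)
  by_cases hq : R < ‖q.1 • u + (q.2 : Cn n)‖
  · simp [hR _ hq]
  · have hle := norm_le_norm_smul_add hu q.1 q.2
    have h3 : q.1 ∈ Metric.closedBall (0 : ℂ) R :=
      mem_closedBall_zero_iff.2 (hle.1.trans (not_lt.1 hq))
    have h4 : q.2 ∈ Metric.closedBall (0 : complexHyperplane u) R :=
      mem_closedBall_zero_iff.2 (hle.2.trans (not_lt.1 hq))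
    simp only [indicator_of_mem h3, indicator_of_mem h4, mul_one]

theorem integrable_comp_inner_mul {k : ℂ → ℝ}
    (hkint : IntegrableOn k (Metric.closedBall 0 R)) {u : Cn n} (hu : ‖u‖ = 1) (hF : Measurable F)
    (hM : ∀ x, |F x| ≤ M) (hR : ∀ x, R < ‖x‖ → F x = 0) :
    Integrable fun x => k (inner ℂ u x) * F x := by
  rw [← (measurePreserving_smul_add hu).integrable_comp_emb (measurableEmbedding_smul_add hu)]
  simpa only [Function.comp_def, inner_smul_add_complexHyperplane hu] using
    integrable_smul_add hkint hu hF hM hR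

/-- On `z u + u^⊥` the factor `k (x · u)` is the constant `k z`, so it leaves the inner integral. -/
theorem integral_comp_inner_mul {k : ℂ → ℝ}
    (hkint : IntegrableOn k (Metric.closedBall 0 R)) {u : Cn n} (hu : ‖u‖ = 1) (hF : Measurable F)
    (hM : ∀ x, |F x| ≤ M) (hR : ∀ x, R < ‖x‖ → F x = 0) :
    ∫ x, k (inner ℂ u x) * F x = ∫ z, k z * hyperplaneIntegral u F z := by
  rw [← (measurePreserving_smul_add hu).integral_comp (measurableEmbedding_smul_add hu)]
  simp only [inner_smul_add_complexHyperplane hu]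
  rw [integral_prod _ (integrable_smul_add hkint hu hF hM hR)]
  simp only [integral_const_mul, hyperplaneIntegral]

end Decomposition

/-! ### Continuity in `u` and the uniform limit `p → -2` for functions on `ℂⁿ`. -/

namespace IsGauge

variable {h : ℂ → ℝ} {n : ℕ} {F : Cn n → ℝ} {M R : ℝ}

theorem integrableOn_rpow_closedBall (hh : IsGauge h) {p : ℝ} (hp : -2 < p) (R : ℝ) :
    IntegrableOn (fun z => h z ^ p) (Metric.closedBall 0 R) := by
  obtain ⟨B, hB, hle⟩ := hh.exists_le_norm
  refine (hh.integrableOn_rpow hp (B * R)).mono_set fun z hz => (hle z).trans ?_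
  rw [mem_closedBall_zero_iff] at hz
  gcongr

/-- Truncating the kernel to `max h ε ^ p` removes its singularity, and dominated convergence gives
continuity; the truncation error tends to zero uniformly in `u`. Measurable `F` are allowed so that
indicators of star bodies are covered. -/
theorem continuous_integral_rpow (hh : IsGauge h) {p : ℝ} (hp : -2 < p) (hF : Measurable F)
    (hM : ∀ x, |F x| ≤ M) (hR : ∀ x, R < ‖x‖ → F x = 0) :
    Continuous fun u : Metric.sphere (0 : Cn n) 1 => ∫ x, h (inner ℂ (u : Cn n) x) ^ p * F x := by
  have hM0 : 0 ≤ M := (abs_nonneg _).trans (hM 0)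
  have hp2 : 0 < p + 2 := by linarith
  have hnorm (u : Metric.sphere (0 : Cn n) 1) : ‖(u : Cn n)‖ = 1 := by simp
  obtain ⟨V, hV0, hV⟩ := exists_volume_closedBall_le n R
  let k (ε : ℝ) (z : ℂ) : ℝ := max (h z) ε ^ p
  have hkc {ε : ℝ} (hε : 0 < ε) : Continuous (k ε) :=
    (hh.continuous.max continuous_const).rpow_const
      fun z => Or.inl (hε.trans_le (le_max_right _ _)).ne'
  have hcont {ε : ℝ} (hε : 0 < ε) : Continuous fun u : Metric.sphere (0 : Cn n) 1 =>
      ∫ x, k ε (inner ℂ (u : Cn n) x) * F x := by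
    obtain ⟨B, hB⟩ := (isCompact_closedBall (0 : ℂ) R).bddAbove_image (hkc hε).abs.continuousOn
    refine continuous_of_dominated
      (bound := (Metric.closedBall (0 : Cn n) R).indicator fun _ => B * M) (fun u => ?_)
      (fun u => Eventually.of_forall fun x => ?_) ?_ (Eventually.of_forall fun x => ?_)
    · exact (((hkc hε).comp (by fun_prop)).measurable.mul hF).aestronglyMeasurable
    · by_cases hx : ‖x‖ ≤ R
      · rw [indicator_of_mem (mem_closedBall_zero_iff.2 hx), norm_mul]
        have h1 : |k ε (inner ℂ (u : Cn n) x)| ≤ B := hB (mem_image_of_mem _ (by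
          rw [mem_closedBall_zero_iff]
          refine (norm_inner_le_norm _ _).trans ?_
          rwa [hnorm u, one_mul]))
        exact mul_le_mul h1 (hM x) (abs_nonneg _) ((abs_nonneg _).trans h1)
      · simp [hR x (not_le.1 hx), hx]
    · exact (integrable_indicator_iff measurableSet_closedBall).2
        (integrableOn_const measure_closedBall_lt_top.ne)
    · exact ((hkc hε).comp (by fun_prop)).mul continuous_const
  -- The kernels differ only on `{h ≤ ε}`, by at most `h ^ p + ε ^ p`. The second summand is `ε ^ p`
  -- times the area of that set, which is the mass formula with exponent `0`; both summands are of
  -- order `ε ^ (p + 2)`.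
  let err (ε : ℝ) : ℝ := gaugeMass h * ε ^ (p + 2) / (p + 2) +
    gaugeMass h * ε ^ (0 + 2 : ℝ) / (0 + 2) * ε ^ p
  have herr0 : Tendsto (fun ε => err ε * (M * V)) (𝓝[>] 0) (𝓝 0) := by
    have h1 : Tendsto (fun ε : ℝ => ε ^ (p + 2)) (𝓝[>] 0) (𝓝 0) := by
      have := (Real.continuousAt_rpow_const (0 : ℝ) (p + 2) (Or.inr hp2.le)).tendsto
      rw [Real.zero_rpow hp2.ne'] at this
      exact this.mono_left nhdsWithin_le_nhds
    have h2 := h1.const_mul ((gaugeMass h / (p + 2) + gaugeMass h / 2) * (M * V))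
    rw [mul_zero] at h2
    refine h2.congr' ?_
    filter_upwards [self_mem_nhdsWithin] with ε hε
    simp only [err, zero_add]
    rw [Real.rpow_add hε]
    ring
  have hdiff {ε : ℝ} (hε : 0 < ε) (u : Metric.sphere (0 : Cn n) 1) :
      |(∫ x, h (inner ℂ (u : Cn n) x) ^ p * F x) - ∫ x, k ε (inner ℂ (u : Cn n) x) * F x| ≤
        err ε * (M * V) := by
    have hi0 := hh.integrableOn_rpow_closedBall hp R
    have hi1 : IntegrableOn (k ε) (Metric.closedBall 0 R) :=
      (hkc hε).continuousOn.integrableOn_compact (isCompact_closedBall _ _)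
    rw [← integral_sub (integrable_comp_inner_mul hi0 (hnorm u) hF hM hR)
      (integrable_comp_inner_mul hi1 (hnorm u) hF hM hR)]
    simp only [← sub_mul]
    rw [integral_comp_inner_mul (k := fun z => h z ^ p - k ε z)
      (hi0.sub hi1) (hnorm u) hF hM hR]
    have hms : MeasurableSet {z | h z ≤ ε} :=
      measurableSet_le hh.continuous.measurable measurable_const
    have hip := hh.integrableOn_rpow hp ε
    have hi0' := hh.integrableOn_rpow (p := 0) (by norm_num) ε
    have hb : Integrable (fun z => {z | h z ≤ ε}.indicator (fun z => h z ^ p + h z ^ (0 : ℝ) * ε ^ p) z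
        * (M * V)) :=
      ((integrable_indicator_iff hms).2 (hip.add (hi0'.mul_const _))).mul_const _
    rw [← Real.norm_eq_abs]
    refine (norm_integral_le_of_norm_le hb (Eventually.of_forall fun z => ?_)).trans_eq ?_
    · rw [norm_mul]
      have hG := abs_hyperplaneIntegral_le (hnorm u) (hV u (hnorm u)) hM hR z
      by_cases hz : h z ≤ ε
      · rw [indicator_of_mem (show z ∈ {z | h z ≤ ε} from hz), Real.rpow_zero, one_mul]
        refine mul_le_mul ?_ hG (abs_nonneg _) ?_
        · have h1 := Real.rpow_nonneg (hh.nonneg z) p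
          have h2 : 0 < ε ^ p := by positivity
          simp only [k, max_eq_right hz]
          rw [Real.norm_eq_abs, abs_le]
          constructor <;> linarith
        · have h1 := Real.rpow_nonneg (hh.nonneg z) p
          positivity
      · simp only [k, max_eq_left (not_le.1 hz).le, sub_self, norm_zero, zero_mul]
        rw [indicator_of_notMem (show z ∉ {z | h z ≤ ε} from hz), zero_mul]
    · rw [integral_mul_const, integral_indicator hms, integral_add hip (hi0'.mul_const _),
        integral_mul_const, hh.setIntegral_rpow hp hε.le, hh.setIntegral_rpow (by norm_num) hε.le]
  refine TendstoUniformly.continuous (p := 𝓝[>] (0 : ℝ))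
    (F := fun ε (u : Metric.sphere (0 : Cn n) 1) => ∫ x, k ε (inner ℂ (u : Cn n) x) * F x) ?_
    (Eventually.frequently (by
      filter_upwards [self_mem_nhdsWithin] with ε hε using hcont hε))
  rw [Metric.tendstoUniformly_iff]
  intro η hη
  filter_upwards [self_mem_nhdsWithin, herr0.eventually_lt_const hη] with ε hε hlt u
  rw [Real.dist_eq]
  exact (hdiff hε u).trans_lt hlt

/-- `F` is uniformly continuous with bounded support, so its hyperplane integrals are continuous at
`z = 0` uniformly in `u`, as the approximate identity requires. -/
theorem tendstoUniformly_integral_rpow (hh : IsGauge h) (hF : Continuous F)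
    (hR : ∀ x, R < ‖x‖ → F x = 0) :
    TendstoUniformly (fun (p : ℝ) (u : Metric.sphere (0 : Cn n) 1) =>
      1 / Real.Gamma (p + 2) * ∫ x, h (inner ℂ (u : Cn n) x) ^ p * F x)
      (fun u => gaugeMass h * hyperplaneIntegral (u : Cn n) F 0) (𝓝[>] (-2)) := by
  have hnorm (u : Metric.sphere (0 : Cn n) 1) : ‖(u : Cn n)‖ = 1 := by simp
  have hcs : HasCompactSupport F := HasCompactSupport.intro (isCompact_closedBall 0 R)
    fun x hx => hR x (by simpa using hx)
  obtain ⟨M, hM⟩ := hF.bounded_above_of_compact_support hcs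
  have hM : ∀ x, |F x| ≤ M := hM
  obtain ⟨V, hV0, hV⟩ := exists_volume_closedBall_le n R
  obtain ⟨V', hV'0, hV'⟩ := exists_volume_closedBall_le n (R + 1)
  obtain ⟨B, hB, hBle⟩ := hh.exists_le_norm
  have huc : UniformContinuous F := hcs.uniformContinuous_of_continuous hF
  -- The pair `(p, u)` serves as index, with no condition on `u`; convergence along this filter is
  -- uniformity in `u`.
  have hfst : Tendsto (Prod.fst : ℝ × Metric.sphere (0 : Cn n) 1 → ℝ) (𝓝[>] (-2) ×ˢ ⊤)
    (𝓝[>] (-2)) := tendsto_fst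
  have key := hh.tendsto_integral (M := M * V) (R := B * R) hfst
    (G := fun i z => hyperplaneIntegral (i.2 : Cn n) F z)
    (fun i z => abs_hyperplaneIntegral_le (hnorm i.2) (hV _ (hnorm i.2)) hM hR z)
    (fun i z hz => hyperplaneIntegral_eq_zero (hnorm i.2) hR
      (lt_of_mul_lt_mul_left (hz.trans_le (hBle z)) hB.le))
    (fun i => (stronglyMeasurable_hyperplaneIntegral hF.measurable _).aestronglyMeasurable) ?_
  · rw [tendstoUniformly_iff_tendsto, Metric.uniformity_eq_comap_nhds_zero, tendsto_comap_iff]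
    have key' := key.abs
    rw [abs_zero] at key'
    refine key'.congr' ?_
    have : ∀ᶠ i : ℝ × Metric.sphere (0 : Cn n) 1 in 𝓝[>] (-2) ×ˢ ⊤, -2 < i.1 :=
      hfst self_mem_nhdsWithin
    filter_upwards [this] with i hi
    rw [Function.comp_apply, Real.dist_eq, abs_sub_comm, integral_comp_inner_mul
      (hh.integrableOn_rpow_closedBall hi R) (hnorm i.2) hF.measurable hM hR]
  · rw [Metric.tendsto_nhds]
    intro ε hε
    -- The tolerance is divided by `V' + 1`, since `V'` may vanish and the final bound must be
    -- strict.
    obtain ⟨δ, hδ, hδF⟩ := Metric.uniformContinuous_iff.1 huc (ε / (V' + 1)) (by positivity)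
    have hev : ∀ᶠ z : ℂ in 𝓝 0, ‖z‖ < min δ 1 := by
      filter_upwards [Metric.ball_mem_nhds (0 : ℂ) (by positivity : 0 < min δ 1)] with z hz
      exact mem_ball_zero_iff.1 hz
    filter_upwards [hev.prod_inr _] with q hq
    obtain ⟨⟨p, u⟩, z⟩ := q
    have hu := hnorm u
    simp only at hq ⊢
    have hint (z : ℂ) : Integrable fun w : complexHyperplane (u : Cn n) =>
        F (z • (u : Cn n) + (w : Cn n)) := by
      refine Continuous.integrable_of_hasCompactSupport (by fun_prop)
        (HasCompactSupport.intro (isCompact_closedBall 0 R) fun w hw => ?_)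
      rw [mem_closedBall_zero_iff, not_le] at hw
      exact hR _ (hw.trans_le (norm_le_norm_smul_add hu z w).2)
    rw [dist_zero_right, hyperplaneIntegral, hyperplaneIntegral, ← integral_sub (hint z) (hint 0)]
    have h1 : ∫ w : complexHyperplane (u : Cn n), (F (z • (u : Cn n) + (w : Cn n)) -
          F ((0 : ℂ) • (u : Cn n) + (w : Cn n))) =
        ∫ w in Metric.closedBall (0 : complexHyperplane (u : Cn n)) (R + 1),
          (F (z • (u : Cn n) + (w : Cn n)) - F ((0 : ℂ) • (u : Cn n) + (w : Cn n))) := by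
      refine (setIntegral_eq_integral_of_forall_compl_eq_zero fun w hw => ?_).symm
      rw [mem_closedBall_zero_iff, not_le] at hw
      have hw' : R < ‖w‖ := by linarith
      rw [hR _ (hw'.trans_le (norm_le_norm_smul_add hu z w).2),
        hR _ (hw'.trans_le (norm_le_norm_smul_add hu 0 w).2), sub_zero]
    rw [h1]
    refine (norm_setIntegral_le_of_norm_le_const (C := ε / (V' + 1)) measure_closedBall_lt_top
      fun w _ => ?_).trans_lt ?_
    · rw [← dist_eq_norm]
      refine (hδF ?_).le
      rw [dist_add_right, zero_smul, dist_zero_right, norm_smul, hu, mul_one]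
      exact hq.trans_le (min_le_left _ _)
    · calc ε / (V' + 1) * _ ≤ ε / (V' + 1) * V' := by gcongr; exact hV' _ hu
        _ < ε := by
          rw [div_mul_eq_mul_div, div_lt_iff₀ (by positivity)]
          linarith

end IsGauge

/-- The tent function supported on `[1, 3]`. -/
noncomputable def tent (r : ℝ) : ℝ := max 0 (1 - |r - 2|)

theorem continuous_tent : Continuous tent := by
  unfold tent
  fun_prop

theorem tent_of_le_one {r : ℝ} (hr : r ≤ 1) : tent r = 0 := by
  rw [tent, max_eq_left]
  have := neg_abs_le (r - 2)
  linarith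

theorem tent_of_three_le {r : ℝ} (hr : 3 ≤ r) : tent r = 0 := by
  rw [tent, max_eq_left]
  have := le_abs_self (r - 2)
  linarith

theorem tent_pos {r : ℝ} (hr : r ∈ Ioo (1 : ℝ) 3) : 0 < tent r := by
  refine lt_max_of_lt_right ?_
  have : |r - 2| < 1 := abs_lt.2 ⟨by linarith [hr.1], by linarith [hr.2]⟩
  linarith

/-- The moments of the tent function. -/
noncomputable def tentMoment (d : ℕ) (p : ℝ) : ℝ :=
  ∫ r in Ioi (0 : ℝ), r ^ d * (r ^ p * tent r)

/-- The tent vanishes outside `[1, 3]`, so `r ^ p` may be replaced by `max r 1 ^ p`. This is jointly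
continuous in `p` and `r`, from which continuity of the moment in `p` follows. -/
theorem tentMoment_eq (d : ℕ) (p : ℝ) :
    tentMoment d p = ∫ r in Icc (1 : ℝ) 3, r ^ d * (max r 1 ^ p * tent r) := by
  rw [tentMoment, ← integral_indicator measurableSet_Ioi, ← integral_indicator measurableSet_Icc]
  congr 1
  ext r
  by_cases h1 : r < 1
  · simp [indicator, h1.not_ge, tent_of_le_one h1.le]
  · by_cases h3 : 3 < r
    · simp [indicator, h3.not_ge, tent_of_three_le h3.le]
    · rw [not_lt] at h1 h3
      rw [indicator_of_mem (mem_Ioi.2 (zero_lt_one.trans_le h1)), indicator_of_mem (mem_Icc.2 ⟨h1, h3⟩),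
        max_eq_left h1]

theorem continuous_tentMoment (d : ℕ) : Continuous (tentMoment d) := by
  have h : Continuous fun q : ℝ × ℝ => q.2 ^ d * (max q.2 1 ^ q.1 * tent q.2) := by
    refine Continuous.mul (by fun_prop) (Continuous.mul ?_ (continuous_tent.comp continuous_snd))
    exact Continuous.rpow (by fun_prop) continuous_fst
      fun q => Or.inl (zero_lt_one.trans_le (le_max_right _ _)).ne'
  have := continuous_parametric_integral_of_continuous (μ := volume)
    (f := fun p r : ℝ => r ^ d * (max r 1 ^ p * tent r)) h (isCompact_Icc (a := (1 : ℝ)) (b := 3))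
  exact this.congr fun p => (tentMoment_eq d p).symm

theorem tentMoment_pos (d : ℕ) (p : ℝ) : 0 < tentMoment d p := by
  rw [tentMoment_eq, integral_Icc_eq_integral_Ioc, ← intervalIntegral.integral_of_le (by norm_num)]
  have hc : Continuous fun r : ℝ => r ^ d * (max r 1 ^ p * tent r) := by
    refine Continuous.mul (by fun_prop) (Continuous.mul ?_ continuous_tent)
    exact Continuous.rpow_const (by fun_prop)
      fun q => Or.inl (zero_lt_one.trans_le (le_max_right _ _)).ne'
  refine intervalIntegral.intervalIntegral_pos_of_pos_on (hc.intervalIntegrable _ _)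
    (fun r hr => ?_) (by norm_num)
  have h0 : 0 < r := zero_lt_one.trans hr.1
  have := tent_pos hr
  positivity

section Nontrivial

variable {n : ℕ}

theorem nontrivial_Cn (hn : 2 ≤ n) : Nontrivial (Cn n) := by
  refine Module.nontrivial_of_finrank_pos (R := ℝ) ?_
  rw [finrank_Cn]
  omega

theorem nontrivial_complexHyperplane (hn : 2 ≤ n) {u : Cn n} (hu : ‖u‖ = 1) :
    Nontrivial (complexHyperplane u) := by
  refine Module.nontrivial_of_finrank_pos (R := ℝ) ?_
  have := finrank_complexHyperplane hu
  omega

end Nontrivial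

/-! ### From functions on `ℂⁿ` to functions on the sphere. -/

namespace IsGauge

variable {h : ℂ → ℝ} {n : ℕ}

theorem inner_smul_rpow (hh : IsGauge h) (p : ℝ) (u v : Cn n) {r : ℝ} (hr : 0 < r) :
    h (inner ℂ u (r • v)) ^ p = h (inner ℂ u v) ^ p * r ^ p := by
  rw [← Complex.coe_smul, inner_smul_right, ← smul_eq_mul, Complex.coe_smul, hh.map_smul r hr.le,
    mul_comm, Real.mul_rpow (hh.nonneg _) hr.le]

theorem integral_polarExt_tent (hh : IsGauge h) (hn : 2 ≤ n) (p : ℝ)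
    (f : Metric.sphere (0 : Cn n) 1 → ℝ) (u : Cn n) :
    ∫ x, h (inner ℂ u x) ^ p * polarExt f tent x =
      (∫ v : Metric.sphere (0 : Cn n) 1, h (inner ℂ u (v : Cn n)) ^ p * f v
        ∂(volume : Measure (Cn n)).toSphere) * tentMoment (2 * n - 1) p := by
  have := nontrivial_Cn hn
  rw [integral_polar_of_eq_mul volume
    (a := fun v : Metric.sphere (0 : Cn n) 1 => h (inner ℂ u (v : Cn n)) ^ p * f v)
    (b := fun r => r ^ p * tent r), finrank_Cn, tentMoment]
  intro v r hr
  rw [hh.inner_smul_rpow p u _ hr, polarExt_smul f tent v hr]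
  ring

theorem hyperplaneIntegral_polarExt_tent (hn : 2 ≤ n) (f : C(Metric.sphere (0 : Cn n) 1, ℝ))
    (u : Metric.sphere (0 : Cn n) 1) :
    hyperplaneIntegral (u : Cn n) (polarExt f tent) 0 =
      complexSphericalRadon f u * tentMoment (2 * n - 1) (-2) := by
  have hu : ‖(u : Cn n)‖ = 1 := by simp
  have := nontrivial_complexHyperplane hn hu
  have hfr := finrank_complexHyperplane hu
  have h1 : hyperplaneIntegral (u : Cn n) (polarExt f tent) 0 =
      ∫ w : complexHyperplane (u : Cn n), polarExt f tent (w : Cn n) := by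
    simp only [hyperplaneIntegral, zero_smul, zero_add]
  have h2 := integral_subspace_polarExt (complexHyperplane (u : Cn n)) f tent
  rw [h1, complexSphericalRadon]
  refine h2.trans ?_
  congr 1
  refine setIntegral_congr_fun measurableSet_Ioi fun r hr => ?_
  have hr : 0 < r := hr
  rw [← mul_assoc]
  congr 1
  -- The hyperplane has real dimension `2n - 2`, so its radial weight is `r ^ (2n - 3) = r ^ (2n -
  -- 1) r ^ (-2)`. Hence the moment here is the ambient one at `p = -2`.
  have e : 2 * n - 1 = Module.finrank ℝ (complexHyperplane (u : Cn n)) - 1 + 2 := by omega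
  rw [e, pow_add, mul_assoc, Real.rpow_neg hr.le]
  norm_cast
  rw [mul_inv_cancel₀ (by positivity), mul_one]

/-- The limit for the tent extension of `f` is divided by the moments, which are positive and
continuous in `p`. Continuity of the Radon transform comes along, as it is a multiple of a uniform
limit of continuous functions. -/
theorem tendstoUniformly_sphericalTransform (hh : IsGauge h) (hn : 2 ≤ n)
    (f : C(Metric.sphere (0 : Cn n) 1, ℝ)) :
    TendstoUniformly (fun (p : ℝ) (u : Metric.sphere (0 : Cn n) 1) => 1 / Real.Gamma (p + 2) *
        ∫ v : Metric.sphere (0 : Cn n) 1, h (inner ℂ (u : Cn n) (v : Cn n)) ^ p * f v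
          ∂(volume : Measure (Cn n)).toSphere)
      (fun u => gaugeMass h * complexSphericalRadon f u) (𝓝[>] (-2)) ∧
    Continuous (complexSphericalRadon f) := by
  have hF : Continuous (polarExt f tent) :=
    continuous_polarExt f.continuous continuous_tent one_pos fun r => tent_of_le_one
  have hR (x : Cn n) (hx : 3 < ‖x‖) : polarExt f tent x = 0 :=
    polarExt_eq_zero f (tent_of_three_le hx.le)
  obtain ⟨M, hM⟩ := hF.bounded_above_of_compact_support
    (HasCompactSupport.intro (isCompact_closedBall 0 3) fun x hx => hR x (by simpa using hx))
  have hunif := hh.tendstoUniformly_integral_rpow hF hR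
  have hm := tentMoment_pos (2 * n - 1) (-2)
  have hc := hh.gaugeMass_pos
  have hcont : Continuous fun u : Metric.sphere (0 : Cn n) 1 =>
      gaugeMass h * hyperplaneIntegral (u : Cn n) (polarExt f tent) 0 := by
    refine hunif.continuous (Eventually.frequently ?_)
    filter_upwards [self_mem_nhdsWithin] with p hp
    exact continuous_const.mul (hh.continuous_integral_rpow hp hF.measurable hM hR)
  simp only [hyperplaneIntegral_polarExt_tent hn f] at hcont hunif
  have hR : Continuous (complexSphericalRadon f) := by
    refine (hcont.const_mul (gaugeMass h * tentMoment (2 * n - 1) (-2))⁻¹).congr fun u => ?_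
    field_simp
  refine ⟨?_, hR⟩
  have hR' : Continuous fun u => gaugeMass h * complexSphericalRadon f u := continuous_const.mul hR
  -- As continuous convergence, the statement admits the ordinary quotient rule for limits.
  rw [tendstoUniformly_iff_forall_tendsto_nhds hcont] at hunif
  rw [tendstoUniformly_iff_forall_tendsto_nhds hR']
  intro u
  have hp : Tendsto (Prod.fst : ℝ × Metric.sphere (0 : Cn n) 1 → ℝ) (𝓝[>] (-2) ×ˢ 𝓝 u) (𝓝 (-2)) :=
    tendsto_fst.mono_right nhdsWithin_le_nhds
  have key := (hunif u).div (((continuous_tentMoment (2 * n - 1)).tendsto (-2)).comp hp) hm.ne'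
  rw [← mul_assoc, mul_div_cancel_right₀ _ hm.ne'] at key
  refine key.congr fun q => ?_
  have := tentMoment_pos (2 * n - 1) q.1
  simp only [Function.comp_apply, hh.integral_polarExt_tent hn, Pi.div_apply]
  field_simp

end IsGauge

/-! ### Star bodies and their radial functions. -/

section StarBody

variable {n : ℕ} {K L : Set (Cn n)}

theorem IsStarBody.isCompact_radial (hK : IsStarBody K) {u : Cn n} (hu : ‖u‖ = 1) :
    IsCompact {t : ℝ | 0 ≤ t ∧ t • u ∈ K} := by
  obtain ⟨R, hR⟩ := hK.isCompact.isBounded.exists_norm_le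
  refine (isCompact_Icc (a := (0 : ℝ)) (b := R)).of_isClosed_subset ?_ fun t ht => ⟨ht.1, ?_⟩
  · exact isClosed_Ici.inter (hK.isCompact.isClosed.preimage (by fun_prop))
  · have := hR _ ht.2
    rwa [norm_smul, hu, mul_one, Real.norm_of_nonneg ht.1] at this

theorem IsStarBody.smul_mem_iff (hK : IsStarBody K) {u : Cn n} (hu : ‖u‖ = 1) {t : ℝ}
    (ht : 0 ≤ t) : t • u ∈ K ↔ t ≤ radialFun K u := by
  have hc := hK.isCompact_radial hu
  refine ⟨fun h => le_csSup hc.bddAbove ⟨ht, h⟩, fun h => ?_⟩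
  have hmem : 0 ≤ radialFun K u ∧ radialFun K u • u ∈ K :=
    hc.sSup_mem ⟨0, le_rfl, by simpa using hK.zero_mem⟩
  have hpos := hK.radial_pos u (by simpa using hu)
  have := hK.starConvex.smul_mem hmem.2 (t := t / radialFun K u) (by positivity)
    ((div_le_one hpos).2 h)
  rwa [smul_smul, div_mul_cancel₀ _ hpos.ne'] at this

theorem norm_inv_norm_smul {E : Type*} [NormedAddCommGroup E] [NormedSpace ℝ E] {x : E}
    (hx : x ≠ 0) : ‖‖x‖⁻¹ • x‖ = 1 := by
  simp [norm_smul, hx]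

theorem IsStarBody.eq_starSet (hK : IsStarBody K) : K = starSet (radialFun K) := by
  ext x
  by_cases hx : x = 0
  · simp [hx, hK.zero_mem, starSet]
  · have h := hK.smul_mem_iff (norm_inv_norm_smul hx) (norm_nonneg x)
    rw [smul_smul, mul_inv_cancel₀ (norm_ne_zero_iff.2 hx), one_smul] at h
    simp [starSet, hx, h]

theorem starSet_congr {ρ ρ' : Cn n → ℝ} (h : ∀ u, ‖u‖ = 1 → ρ u = ρ' u) :
    starSet ρ = starSet ρ' := by
  ext x
  by_cases hx : x = 0
  · simp [starSet, hx]
  · simp only [starSet, mem_ofPred_eq, h _ (norm_inv_norm_smul hx)]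

theorem IsStarBody.ext (hK : IsStarBody K) (hL : IsStarBody L)
    (h : ∀ u, ‖u‖ = 1 → radialFun K u = radialFun L u) : K = L := by
  rw [hK.eq_starSet, hL.eq_starSet, starSet_congr h]

theorem isStarBody_starSet {ρ : Cn n → ℝ} (hpos : ∀ u, ‖u‖ = 1 → 0 < ρ u)
    (hcont : Continuous fun u : Metric.sphere (0 : Cn n) 1 => ρ u) : IsStarBody (starSet ρ) where
  isCompact := by
    -- Compactness: apart from the origin the set is a continuous image of the sphere times `[0,
    -- 1]`. The origin is added separately because the sphere may be empty.
    have himg : starSet ρ = {0} ∪ (fun q : Metric.sphere (0 : Cn n) 1 × ℝ =>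
        (q.2 * ρ q.1) • (q.1 : Cn n)) '' (univ ×ˢ Icc 0 1) := by
      ext x
      simp only [starSet, mem_ofPred_eq, mem_union, mem_singleton_iff, mem_image, mem_prod,
        mem_univ, true_and, Prod.exists]
      by_cases hx : x = 0
      · simp [hx]
      simp only [hx, false_or]
      have hx' := norm_ne_zero_iff.2 hx
      constructor
      · intro h
        have h0 := hpos _ (norm_inv_norm_smul hx)
        refine ⟨⟨‖x‖⁻¹ • x, mem_sphere_zero_iff_norm.2 (norm_inv_norm_smul hx)⟩,
          ‖x‖ / ρ (‖x‖⁻¹ • x), ⟨by positivity, (div_le_one h0).2 h⟩, ?_⟩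
        simp only
        rw [div_mul_cancel₀ _ h0.ne', smul_smul, mul_inv_cancel₀ hx', one_smul]
      · rintro ⟨v, t, ht, rfl⟩
        have hv : ‖(v : Cn n)‖ = 1 := by simp
        have h0 := hpos v hv
        have hne : t * ρ v ≠ 0 := fun h => hx (by rw [h, zero_smul])
        have hp : 0 < t * ρ v := lt_of_le_of_ne (mul_nonneg ht.1 h0.le) hne.symm
        rw [norm_smul, hv, mul_one, Real.norm_of_nonneg hp.le, smul_smul, inv_mul_cancel₀ hne,
          one_smul]
        exact mul_le_of_le_one_left h0.le ht.2
    rw [himg]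
    refine isCompact_singleton.union ((isCompact_univ.prod isCompact_Icc).image ?_)
    exact (continuous_snd.mul (hcont.comp continuous_fst)).smul
      (continuous_subtype_val.comp continuous_fst)
  zero_mem := Or.inl rfl
  starConvex := by
    refine starConvex_zero_iff.2 fun x hx a ha0 ha1 => ?_
    rcases hx with rfl | hx
    · simp [starSet]
    · by_cases hax : a • x = 0
      · exact Or.inl hax
      · have ha : 0 < a := lt_of_le_of_ne ha0 fun h => hax (by rw [← h, zero_smul])
        refine Or.inr ?_
        rw [norm_smul, Real.norm_of_nonneg ha0, smul_smul, mul_inv_rev, mul_assoc,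
          inv_mul_cancel₀ ha.ne', mul_one]
        exact (mul_le_of_le_one_left (norm_nonneg x) ha1).trans hx
  radial_pos u hu := by
    have hu := mem_sphere_zero_iff_norm.1 hu
    rw [radialFun_starSet ρ hu (hpos u hu).le]
    exact hpos u hu
  radial_continuousOn := by
    have : ContinuousOn ρ (Metric.sphere (0 : Cn n) 1) :=
      continuousOn_iff_continuous_domRestrict.2 hcont
    refine this.congr fun u hu => ?_
    have hu := mem_sphere_zero_iff_norm.1 hu
    exact radialFun_starSet ρ hu (hpos u hu).le

theorem radialFun_smul {a : ℝ} (ha : 0 < a) (K : Set (Cn n)) (u : Cn n) :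
    radialFun (a • K) u = a * radialFun K u := by
  rw [radialFun, radialFun, ← smul_eq_mul, ← Real.sSup_smul_of_nonneg ha.le]
  congr 1
  ext t
  rw [mem_smul_set_iff_inv_smul_mem₀ ha.ne', mem_ofPred_eq, mem_ofPred_eq,
    mem_smul_set_iff_inv_smul_mem₀ ha.ne', smul_smul, smul_eq_mul]
  have : 0 ≤ a⁻¹ * t ↔ 0 ≤ t := by
    rw [mul_nonneg_iff_of_pos_left (inv_pos.2 ha)]
  rw [this]

theorem IsStarBody.continuous_radialFun (hK : IsStarBody K) :
    Continuous fun u : Metric.sphere (0 : Cn n) 1 => radialFun K u :=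
  continuousOn_iff_continuous_domRestrict.1 hK.radial_continuousOn

theorem IsStarBody.radialFun_pos (hK : IsStarBody K) (u : Metric.sphere (0 : Cn n) 1) :
    0 < radialFun K u :=
  hK.radial_pos u u.2

theorem isCircleInvariant_starSet {ρ : Cn n → ℝ}
    (h : ∀ c : ℂ, ‖c‖ = 1 → ∀ u, ‖u‖ = 1 → ρ (c • u) = ρ u) : IsCircleInvariant (starSet ρ) := by
  intro c hc
  have hc0 : c ≠ 0 := fun h0 => by simp [h0] at hc
  ext x
  rw [mem_smul_set_iff_inv_smul_mem₀ hc0]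
  have hci : ‖c⁻¹‖ = 1 := by rw [norm_inv, hc, inv_one]
  by_cases hx : x = 0
  · simp [hx, starSet]
  · have hcx : c⁻¹ • x ≠ 0 := smul_ne_zero (inv_ne_zero hc0) hx
    simp only [starSet, mem_ofPred_eq, hx, hcx, false_or, norm_smul, hci, one_mul]
    rw [smul_comm, h _ hci _ (norm_inv_norm_smul hx)]

theorem IsCircleInvariant.radialFun_smul (hL : IsCircleInvariant L) {c : ℂ} (hc : ‖c‖ = 1)
    (u : Cn n) : radialFun L (c • u) = radialFun L u := by
  have hc0 : c ≠ 0 := fun h0 => by simp [h0] at hc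
  rw [radialFun, radialFun]
  congr 1
  ext t
  refine and_congr_right fun _ => ?_
  nth_rewrite 1 [← hL c hc]
  rw [smul_comm, smul_mem_smul_set_iff₀ hc0]

end StarBody

/-! ### Volumes and spherical integrals of sections. -/

section Sections

variable {E : Type*} [NormedAddCommGroup E] [InnerProductSpace ℝ E] [FiniteDimensional ℝ E]
  [MeasurableSpace E] [BorelSpace E]

/-- The inclusion of the unit sphere of a subspace into the unit sphere of the ambient space. -/
def sphereInclusion (W : Submodule ℝ E) (v : Metric.sphere (0 : W) 1) :
    Metric.sphere (0 : E) 1 :=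
  ⟨((v : W) : E), mem_sphere_zero_iff_norm.2 (mem_sphere_zero_iff_norm.1 v.2)⟩

omit [FiniteDimensional ℝ E] [MeasurableSpace E] [BorelSpace E] in
theorem continuous_sphereInclusion (W : Submodule ℝ E) : Continuous (sphereInclusion W) :=
  (continuous_subtype_val.comp continuous_subtype_val).subtype_mk _

theorem sectionVolume_eq (W : Submodule ℝ E) [Nontrivial W] {K : Set E} (hK : MeasurableSet K)
    {ρ : Metric.sphere (0 : E) 1 → ℝ} (hρ : ∀ v, 0 ≤ ρ v) (hcont : Continuous ρ)
    (hmem : ∀ (v : Metric.sphere (0 : E) 1) (r : ℝ), 0 < r → (r • (v : E) ∈ K ↔ r ≤ ρ v)) :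
    sectionVolume W K = ENNReal.ofReal
      (sphereSectionIntegral W (fun v => ρ v ^ Module.finrank ℝ W) / Module.finrank ℝ W) := by
  classical
  have hd : 0 < Module.finrank ℝ W := Module.finrank_pos
  have hms : MeasurableSet ((fun w : W => (w : E)) ⁻¹' K) := hK.preimage measurable_subtype_coe
  rw [sectionVolume, ← lintegral_indicator_one hms,
    lintegral_polar_of_eq_rpow (p := 0) volume (a := fun _ => 1)
      (ρ := fun v => ρ (sphereInclusion W v))]
  · have hc : Continuous fun v : Metric.sphere (0 : W) 1 =>
        ρ (sphereInclusion W v) ^ Module.finrank ℝ W / Module.finrank ℝ W :=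
      ((hcont.comp (continuous_sphereInclusion W)).pow _).div_const _
    rw [sphereSectionIntegral, ← integral_div, ofReal_integral_eq_lintegral_ofReal]
    · refine lintegral_congr fun v => ?_
      simp only [add_zero, one_mul, Real.rpow_natCast]
      rfl
    · exact hc.integrable_of_hasCompactSupport (HasCompactSupport.of_compactSpace _)
    · exact Eventually.of_forall fun v => div_nonneg (pow_nonneg (hρ _) _) (by positivity)
  · simpa using hd
  · exact measurable_one.indicator hms
  · exact fun v => hρ _
  · intro v r hr
    have := hmem (sphereInclusion W v) r hr
    simp only [indicator, Real.rpow_zero, ENNReal.ofReal_one, mul_one, Pi.one_apply]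
    exact if_congr this rfl rfl
  · exact fun v => ENNReal.one_ne_top

theorem sectionVolume_range {V : Type*} [NormedAddCommGroup V] [InnerProductSpace ℝ V]
    [FiniteDimensional ℝ V] [MeasurableSpace V] [BorelSpace V] (j : V →ₗᵢ[ℝ] E) {W : Submodule ℝ E}
    (hW : W = LinearMap.range j.toLinearMap) (A : Set E) :
    sectionVolume W A = volume (j ⁻¹' A) := by
  subst hW
  rw [sectionVolume, ← j.equivRange.measurePreserving.measure_preimage_emb
    j.equivRange.toHomeomorph.measurableEmbedding]
  rfl

theorem sphereSectionIntegral_pos (W : Submodule ℝ E) [Nontrivial W]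
    {f : Metric.sphere (0 : E) 1 → ℝ} (hf : Continuous f) (hpos : ∀ v, 0 < f v) :
    0 < sphereSectionIntegral W f := by
  obtain ⟨v⟩ : Nonempty (Metric.sphere (0 : W) 1) :=
    (NormedSpace.sphere_nonempty.2 zero_le_one).to_subtype
  exact (hf.comp (continuous_sphereInclusion W)).integral_pos_of_hasCompactSupport_nonneg_nonzero
    (HasCompactSupport.of_compactSpace _) (fun v => (hpos _).le) (x := v) (hpos _).ne'

theorem sphereSectionIntegral_comp_isometry (W : Submodule ℝ E) [Nontrivial W] (e : E →ₗᵢ[ℝ] E)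
    (he : ∀ x ∈ W, e x ∈ W) (f g : Metric.sphere (0 : E) 1 → ℝ)
    (h : ∀ v w : Metric.sphere (0 : E) 1, (w : E) = e v → g v = f w) :
    sphereSectionIntegral W g = sphereSectionIntegral W f := by
  let eW : W →ₗᵢ[ℝ] W := ⟨e.toLinearMap.restrict he, fun w => e.norm_map w⟩
  refine integral_toSphere_comp_isometry (eW.toLinearIsometryEquiv rfl) _ _ fun v w hvw => ?_
  exact h _ _ (congrArg Subtype.val hvw)

theorem sphereSectionIntegral_intervalIntegral (W : Submodule ℝ E)
    {g : Metric.sphere (0 : E) 1 → ℝ → ℝ} (hg : Continuous (Function.uncurry g)) {B : ℝ}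
    (hB : ∀ v t, |g v t| ≤ B) {a b : ℝ} (hab : a ≤ b) :
    sphereSectionIntegral W (fun v => ∫ t in a..b, g v t) =
      ∫ t in a..b, sphereSectionIntegral W fun v => g v t := by
  simp only [sphereSectionIntegral, intervalIntegral.integral_of_le hab]
  refine integral_integral_swap ?_
  have hc : Continuous fun q : Metric.sphere (0 : W) 1 × ℝ => g (sphereInclusion W q.1) q.2 :=
    hg.comp (((continuous_sphereInclusion W).comp continuous_fst).prodMk continuous_snd)
  exact Integrable.of_bound hc.aestronglyMeasurable B (Eventually.of_forall fun q => hB _ _)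

end Sections

/-! ### Sections with complex lines. -/

section ComplexLine

variable {n : ℕ} {L : Set (Cn n)}

theorem complexLine_eq_range {u : Cn n} (hu : ‖u‖ = 1) :
    complexLine u = LinearMap.range (complexLineIsometry hu).toLinearMap := by
  ext x
  simp only [complexLine, Submodule.restrictScalars_mem, Submodule.mem_span_singleton,
    LinearMap.mem_range]
  rfl

/-- A circle-invariant star body meets a complex line in a disc, whose radius is the radial
function. -/
theorem sectionVolume_complexLine (hL : IsStarBody L) (hinv : IsCircleInvariant L) {u : Cn n}
    (hu : ‖u‖ = 1) :
    sectionVolume (complexLine u) L = ENNReal.ofReal (Real.pi * radialFun L u ^ 2) := by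
  have hpos := hL.radial_pos u (by simpa using hu)
  have hpre : complexLineIsometry hu ⁻¹' L = Metric.closedBall 0 (radialFun L u) := by
    ext z
    rw [mem_closedBall_zero_iff, mem_preimage]
    change z • u ∈ L ↔ _
    by_cases hz : z = 0
    · simp [hz, hL.zero_mem, hpos.le]
    have hz' : (‖z‖ : ℂ) ≠ 0 := by simpa using hz
    have hc : ‖z / ‖z‖‖ = 1 := by
      rw [norm_div, Complex.norm_real, norm_norm, div_self (norm_ne_zero_iff.2 hz)]
    have hv : ‖(z / ‖z‖) • u‖ = 1 := by rw [norm_smul, hc, hu, one_mul]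
    have h := hL.smul_mem_iff hv (norm_nonneg z)
    rw [hinv.radialFun_smul hc] at h
    rw [← h, ← Complex.coe_smul, smul_smul, mul_div_cancel₀ _ hz']
  rw [sectionVolume_range _ (complexLine_eq_range hu), hpre, Complex.volume_closedBall,
    mul_comm Real.pi, ENNReal.ofReal_mul (by positivity), ENNReal.ofReal_pow hpos.le]
  congr 1
  rw [← NNReal.coe_real_pi, ENNReal.ofReal_coe_nnreal]

theorem complexHyperplane_smul {c : ℂ} (hc : c ≠ 0) (u : Cn n) :
    complexHyperplane (c • u) = complexHyperplane u := by
  rw [complexHyperplane, complexHyperplane, Submodule.span_singleton_smul_eq (IsUnit.mk0 c hc)]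

end ComplexLine

/-! ### Integrals of the kernel over star bodies. -/

namespace IsGauge

variable {h : ℂ → ℝ} {n : ℕ} {K : Set (Cn n)} {p : ℝ}

theorem measurable_comp_inner_rpow (hh : IsGauge h) (p : ℝ) (u : Cn n) :
    Measurable fun x : Cn n => h (inner ℂ u x) ^ p :=
  (hh.measurable_rpow p).comp (by fun_prop)

theorem integrableOn_starBody (hh : IsGauge h) (hp : -2 < p) (hK : IsStarBody K) {u : Cn n}
    (hu : ‖u‖ = 1) : IntegrableOn (fun x => h (inner ℂ u x) ^ p) K := by
  classical
  have hKm := hK.isCompact.isClosed.measurableSet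
  obtain ⟨R, hR⟩ := hK.isCompact.isBounded.exists_norm_le
  have := integrable_comp_inner_mul (M := 1) (F := K.indicator fun _ => 1)
    (hh.integrableOn_rpow_closedBall hp R) hu (measurable_const.indicator hKm)
    (fun x => by by_cases hx : x ∈ K <;> simp [hx])
    (fun x hx => indicator_of_notMem (fun hxK => hx.not_ge (hR x hxK)) _)
  rw [← integrable_indicator_iff hKm]
  refine this.congr (Eventually.of_forall fun x => ?_)
  by_cases hx : x ∈ K <;> simp [hx]

theorem continuous_setIntegral_starBody (hh : IsGauge h) (hp : -2 < p) (hK : IsStarBody K) :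
    Continuous fun u : Metric.sphere (0 : Cn n) 1 => ∫ x in K, h (inner ℂ (u : Cn n) x) ^ p := by
  classical
  have hKm := hK.isCompact.isClosed.measurableSet
  obtain ⟨R, hR⟩ := hK.isCompact.isBounded.exists_norm_le
  have := hh.continuous_integral_rpow (M := 1) (F := K.indicator fun _ => 1) hp
    (measurable_const.indicator hKm)
    (fun x => by by_cases hx : x ∈ K <;> simp [hx])
    (fun x hx => indicator_of_notMem (fun hxK => hx.not_ge (hR x hxK)) _)
  refine this.congr fun u => ?_
  rw [← integral_indicator hKm]
  refine integral_congr_ae (Eventually.of_forall fun x => ?_)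
  by_cases hx : x ∈ K <;> simp [hx]

/-- By compactness of the sphere `K` contains a ball, and the integrand is positive on the nonempty
open part of it where `x · u ≠ 0`. -/
theorem setIntegral_starBody_pos (hh : IsGauge h) (hp : -2 < p) (hK : IsStarBody K)
    (u : Metric.sphere (0 : Cn n) 1) : 0 < ∫ x in K, h (inner ℂ (u : Cn n) x) ^ p := by
  have hu : ‖(u : Cn n)‖ = 1 := by simp
  have hc := hK.continuous_radialFun
  obtain ⟨v₀, -, hv₀⟩ := isCompact_univ.exists_isMinOn ⟨u, mem_univ u⟩ hc.continuousOn
  have hr := hK.radialFun_pos v₀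
  set r := radialFun K v₀
  rw [setIntegral_pos_iff_support_of_nonneg_ae
    (Eventually.of_forall fun x => Real.rpow_nonneg (hh.nonneg _) _)
    (hh.integrableOn_starBody hp hK hu)]
  have hopen : IsOpen (Metric.ball (0 : Cn n) r ∩ {x | inner ℂ (u : Cn n) x ≠ (0 : ℂ)}) :=
    Metric.isOpen_ball.inter (isOpen_ne_fun (by fun_prop) continuous_const)
  have hne : (Metric.ball (0 : Cn n) r ∩ {x | inner ℂ (u : Cn n) x ≠ (0 : ℂ)}).Nonempty := by
    refine ⟨(r / 2) • (u : Cn n), ?_, ?_⟩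
    · rw [mem_ball_zero_iff, norm_smul, hu, mul_one, Real.norm_of_nonneg (by positivity)]
      linarith
    · rw [mem_ofPred_eq, ← Complex.coe_smul, inner_smul_right, inner_self_eq_norm_sq_to_K, hu]
      simp [hr.ne']
  refine (hopen.measure_pos volume hne).trans_le (measure_mono fun x hx => ⟨?_, ?_⟩)
  · exact (Real.rpow_pos_of_pos (hh.pos _ hx.2) _).ne'
  · have hx0 : x ≠ 0 := fun h0 => hx.2 (by rw [h0, inner_zero_right])
    have hmin : r ≤ radialFun K (‖x‖⁻¹ • x) :=
      isMinOn_iff.1 hv₀ ⟨‖x‖⁻¹ • x, mem_sphere_zero_iff_norm.2 (norm_inv_norm_smul hx0)⟩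
        (mem_univ _)
    rw [hK.eq_starSet]
    exact Or.inr ((mem_ball_zero_iff.1 hx.1).le.trans hmin)

/-- Stated for the Lebesgue integral in `[0, ∞]` so that finiteness can be carried over between `K`
and the sphere. -/
theorem setLIntegral_starBody (hh : IsGauge h) (hn : 2 ≤ n) (hp : -2 < p) (hK : IsStarBody K)
    (u : Cn n) : ∫⁻ x in K, ENNReal.ofReal (h (inner ℂ u x) ^ p) =
      ∫⁻ v : Metric.sphere (0 : Cn n) 1, ENNReal.ofReal (h (inner ℂ u (v : Cn n)) ^ p *
        (radialFun K v ^ (2 * n + p) / (2 * n + p))) ∂(volume : Measure (Cn n)).toSphere := by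
  classical
  have := nontrivial_Cn hn
  have hKm := hK.isCompact.isClosed.measurableSet
  have hn' : (2 : ℝ) ≤ n := by exact_mod_cast hn
  rw [← lintegral_indicator hKm, lintegral_polar_of_eq_rpow (p := p) volume
    (a := fun v => ENNReal.ofReal (h (inner ℂ u (v : Cn n)) ^ p))
    (ρ := fun v => radialFun K v)]
  · refine lintegral_congr fun v => ?_
    rw [ENNReal.ofReal_mul (Real.rpow_nonneg (hh.nonneg _) _), finrank_Cn]
    norm_cast
  · rw [finrank_Cn]
    push_cast
    linarith
  · exact (hh.measurable_comp_inner_rpow p u).ennreal_ofReal.indicator hKm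
  · exact fun v => (hK.radialFun_pos v).le
  · intro v r hr
    simp only [indicator, hh.inner_smul_rpow p u _ hr, hK.smul_mem_iff (norm_eq_of_mem_sphere v) hr.le,
      ENNReal.ofReal_mul (Real.rpow_nonneg (hh.nonneg _) _)]
  · exact fun v => ENNReal.ofReal_ne_top

theorem aestronglyMeasurable_sphere (hh : IsGauge h) (p : ℝ) (u : Cn n)
    {f : Metric.sphere (0 : Cn n) 1 → ℝ} (hf : Continuous f) :
    AEStronglyMeasurable (fun v : Metric.sphere (0 : Cn n) 1 => h (inner ℂ u (v : Cn n)) ^ p * f v)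
      (volume : Measure (Cn n)).toSphere :=
  (((hh.measurable_comp_inner_rpow p u).comp measurable_subtype_coe).mul
    hf.measurable).aestronglyMeasurable

theorem setIntegral_starBody (hh : IsGauge h) (hn : 2 ≤ n) (hp : -2 < p) (hK : IsStarBody K)
    (u : Cn n) : ∫ x in K, h (inner ℂ u x) ^ p =
      (∫ v : Metric.sphere (0 : Cn n) 1, h (inner ℂ u (v : Cn n)) ^ p *
        radialFun K v ^ (2 * n + p) ∂(volume : Measure (Cn n)).toSphere) / (2 * n + p) := by
  have hn' : (2 : ℝ) ≤ n := by exact_mod_cast hn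
  have hc : Continuous fun v : Metric.sphere (0 : Cn n) 1 =>
      radialFun K v ^ (2 * n + p) / (2 * n + p) :=
    (hK.continuous_radialFun.rpow_const fun v => Or.inl (hK.radialFun_pos v).ne').div_const _
  rw [← integral_div, integral_eq_lintegral_of_nonneg_ae
    (Eventually.of_forall fun x => Real.rpow_nonneg (hh.nonneg _) _)
    (hh.measurable_comp_inner_rpow p u).aestronglyMeasurable, hh.setLIntegral_starBody hn hp hK]
  simp only [mul_div_assoc]
  rw [integral_eq_lintegral_of_nonneg_ae _ (hh.aestronglyMeasurable_sphere p u hc)]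
  refine Eventually.of_forall fun v => mul_nonneg (Real.rpow_nonneg (hh.nonneg _) _) ?_
  exact div_nonneg (Real.rpow_nonneg (hK.radialFun_pos v).le _) (by linarith)

/-- The unit ball is a star body with radial function `1`; finiteness of the integral over it gives
integrability of the kernel on the sphere. -/
theorem integrable_sphere (hh : IsGauge h) (hn : 2 ≤ n) (hp : -2 < p)
    {u : Cn n} (hu : ‖u‖ = 1) {f : Metric.sphere (0 : Cn n) 1 → ℝ} (hf : Continuous f) :
    Integrable (fun v : Metric.sphere (0 : Cn n) 1 => h (inner ℂ u (v : Cn n)) ^ p * f v)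
      (volume : Measure (Cn n)).toSphere := by
  have hn' : (2 : ℝ) ≤ n := by exact_mod_cast hn
  have hB : IsStarBody (starSet fun _ : Cn n => (1 : ℝ)) :=
    isStarBody_starSet (fun _ _ => one_pos) continuous_const
  have h1 (v : Metric.sphere (0 : Cn n) 1) : radialFun (starSet fun _ : Cn n => (1 : ℝ)) v = 1 :=
    radialFun_starSet _ (norm_eq_of_mem_sphere v) zero_le_one
  have hint : Integrable (fun v : Metric.sphere (0 : Cn n) 1 =>
      h (inner ℂ u (v : Cn n)) ^ p * (1 / (2 * n + p))) (volume : Measure (Cn n)).toSphere := by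
    refine ⟨hh.aestronglyMeasurable_sphere p u continuous_const, ?_⟩
    rw [hasFiniteIntegral_iff_ofReal (Eventually.of_forall fun v =>
      mul_nonneg (Real.rpow_nonneg (hh.nonneg _) _) (div_nonneg zero_le_one (by linarith)))]
    have h2 := hh.setLIntegral_starBody hn hp hB u
    simp only [h1, Real.one_rpow] at h2
    rw [← h2, ← hasFiniteIntegral_iff_ofReal
      (Eventually.of_forall fun x => Real.rpow_nonneg (hh.nonneg _) _)]
    exact (hh.integrableOn_starBody hp hB hu).2
  obtain ⟨M, hM⟩ := isCompact_univ.bddAbove_image hf.abs.continuousOn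
  have hf' : Continuous fun v => (2 * n + p) * f v := continuous_const.mul hf
  refine (hint.mul_bdd (c := (2 * n + p) * M) hf'.aestronglyMeasurable
    (Eventually.of_forall fun v => ?_)).congr (Eventually.of_forall fun v => ?_)
  · rw [norm_mul, Real.norm_of_nonneg (by linarith)]
    have : ‖f v‖ ≤ M := hM (mem_image_of_mem _ (mem_univ v))
    have h0 : 0 ≤ 2 * (n : ℝ) + p := by linarith
    gcongr
  · have h0 : 2 * (n : ℝ) + p ≠ 0 := by linarith
    field_simp

/-- The function `ρ_K ^ (2n - 2)` on the unit sphere. -/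
noncomputable def _root_.IsStarBody.radialPow (hK : IsStarBody K) :
    C(Metric.sphere (0 : Cn n) 1, ℝ) :=
  ⟨fun v => radialFun K v ^ (2 * n - 2), hK.continuous_radialFun.pow _⟩

theorem tendsto_setIntegral_starBody (hh : IsGauge h) (hn : 2 ≤ n) (hK : IsStarBody K)
    (u : Metric.sphere (0 : Cn n) 1) :
    Tendsto (fun q : ℝ × Metric.sphere (0 : Cn n) 1 => 1 / Real.Gamma (q.1 + 2) *
        ∫ x in K, h (inner ℂ (q.2 : Cn n) x) ^ q.1) (𝓝[>] (-2) ×ˢ 𝓝 u)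
      (𝓝 (gaugeMass h * complexSphericalRadon hK.radialPow u / (2 * n - 2))) := by
  have hn' : (2 : ℝ) ≤ n := by exact_mod_cast hn
  have hpos (v : Metric.sphere (0 : Cn n) 1) := hK.radialFun_pos v
  have hfst : Tendsto (Prod.fst : ℝ × Metric.sphere (0 : Cn n) 1 → ℝ) (𝓝[>] (-2) ×ˢ 𝓝 u)
    (𝓝[>] (-2)) := tendsto_fst
  have hp0 : Tendsto (Prod.fst : ℝ × Metric.sphere (0 : Cn n) 1 → ℝ) (𝓝[>] (-2) ×ˢ 𝓝 u)
    (𝓝 (-2)) := hfst.mono_right nhdsWithin_le_nhds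
  let J (p : ℝ) (u : Metric.sphere (0 : Cn n) 1) (f : Metric.sphere (0 : Cn n) 1 → ℝ) : ℝ :=
    ∫ v : Metric.sphere (0 : Cn n) 1, h (inner ℂ (u : Cn n) (v : Cn n)) ^ p * f v
      ∂(volume : Measure (Cn n)).toSphere
  have hlim (f : C(Metric.sphere (0 : Cn n) 1, ℝ)) : Tendsto
      (fun q : ℝ × Metric.sphere (0 : Cn n) 1 => 1 / Real.Gamma (q.1 + 2) * J q.1 q.2 f)
      (𝓝[>] (-2) ×ˢ 𝓝 u) (𝓝 (gaugeMass h * complexSphericalRadon f u)) := by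
    obtain ⟨h1, h2⟩ := hh.tendstoUniformly_sphericalTransform hn f
    have h2' : Continuous fun u => gaugeMass h * complexSphericalRadon f u :=
      continuous_const.mul h2
    exact (tendstoUniformly_iff_forall_tendsto_nhds h2').1 h1 u
  have hfp (p : ℝ) : Continuous fun v : Metric.sphere (0 : Cn n) 1 =>
      radialFun K v ^ (2 * n + p) :=
    hK.continuous_radialFun.rpow_const fun v => Or.inl (hpos v).ne'
  have hunif : TendstoUniformly (fun (p : ℝ) (v : Metric.sphere (0 : Cn n) 1) =>
      radialFun K v ^ (2 * n + p)) hK.radialPow (𝓝[>] (-2)) := by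
    rw [tendstoUniformly_iff_forall_tendsto_nhds hK.radialPow.continuous]
    intro v
    have hq : Tendsto (Prod.fst : ℝ × Metric.sphere (0 : Cn n) 1 → ℝ) (𝓝[>] (-2) ×ˢ 𝓝 v)
      (𝓝 (-2)) := tendsto_fst.mono_right nhdsWithin_le_nhds
    have h1 := ((hK.continuous_radialFun.tendsto v).comp
      (tendsto_snd (f := 𝓝[>] (-2 : ℝ)) (g := 𝓝 v))).rpow (hq.const_add (2 * (n : ℝ)))
        (Or.inl (hpos v).ne')
    have h2 : radialFun K v ^ (2 * (n : ℝ) + -2) = hK.radialPow v := by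
      change _ = radialFun K v ^ (2 * n - 2)
      rw [← Real.rpow_natCast, Nat.cast_sub (by omega)]
      push_cast
      rw [sub_eq_add_neg]
    rw [h2] at h1
    exact h1
  -- The density `ρ_K ^ (2n + p)` varies with `p`. Replacing it by its uniform limit costs at most
  -- `η` times the normalized transform of `1`, which converges and so is eventually below `|B| +
  -- 1`.
  have hdiff : Tendsto (fun q : ℝ × Metric.sphere (0 : Cn n) 1 => 1 / Real.Gamma (q.1 + 2) *
      J q.1 q.2 (fun v => radialFun K v ^ (2 * n + q.1)) - 1 / Real.Gamma (q.1 + 2) *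
        J q.1 q.2 hK.radialPow) (𝓝[>] (-2) ×ˢ 𝓝 u) (𝓝 0) := by
    rw [Metric.tendsto_nhds]
    intro ε hε
    have h1 := hlim 1
    set B := gaugeMass h * complexSphericalRadon 1 u
    have hB : B < |B| + 1 := by linarith [le_abs_self B]
    set η := ε / (|B| + 1)
    have hη : 0 < η := by positivity
    have hev := hfst.eventually (Metric.tendstoUniformly_iff.1 hunif η hη)
    filter_upwards [hev, h1.eventually_lt_const hB, hfst self_mem_nhdsWithin] with q hq hqB hq2
    have hq2 : -2 < q.1 := hq2
    have hΓ := Real.Gamma_pos_of_pos (show 0 < q.1 + 2 by linarith)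
    have hu := norm_eq_of_mem_sphere q.2
    have hi1 := hh.integrable_sphere hn hq2 hu (hfp q.1)
    have hi2 := hh.integrable_sphere hn hq2 hu hK.radialPow.continuous
    have hi3 := hh.integrable_sphere hn hq2 hu
      (ContinuousMap.continuous (1 : C(Metric.sphere (0 : Cn n) 1, ℝ)))
    have key : |J q.1 q.2 (fun v => radialFun K v ^ (2 * n + q.1)) - J q.1 q.2 hK.radialPow| ≤
        η * J q.1 q.2 (1 : C(Metric.sphere (0 : Cn n) 1, ℝ)) := by
      simp only [J]
      rw [← integral_sub hi1 hi2, ← integral_const_mul, ← Real.norm_eq_abs]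
      refine norm_integral_le_of_norm_le (hi3.const_mul η) (Eventually.of_forall fun v => ?_)
      have h0 := Real.rpow_nonneg (hh.nonneg (inner ℂ (q.2 : Cn n) (v : Cn n))) q.1
      rw [← mul_sub, norm_mul, Real.norm_of_nonneg h0, ContinuousMap.one_apply, mul_one, mul_comm]
      gcongr
      rw [← dist_eq_norm, dist_comm]
      exact (hq v).le
    rw [dist_zero_right, ← mul_sub, norm_mul, Real.norm_of_nonneg (by positivity)]
    calc _ ≤ 1 / Real.Gamma (q.1 + 2) *
          (η * J q.1 q.2 (1 : C(Metric.sphere (0 : Cn n) 1, ℝ))) :=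
          mul_le_mul_of_nonneg_left key (by positivity)
      _ = η * (1 / Real.Gamma (q.1 + 2) *
          J q.1 q.2 (1 : C(Metric.sphere (0 : Cn n) 1, ℝ))) := by ring
      _ < η * (|B| + 1) := by gcongr
      _ = ε := div_mul_cancel₀ _ (by positivity)
  have hsum := hdiff.add (hlim hK.radialPow)
  simp only [sub_add_cancel, zero_add] at hsum
  have hden : Tendsto (fun q : ℝ × Metric.sphere (0 : Cn n) 1 => 2 * (n : ℝ) + q.1)
      (𝓝[>] (-2) ×ˢ 𝓝 u) (𝓝 (2 * n - 2)) := hp0.const_add _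
  refine (hsum.div hden (by linarith)).congr' ?_
  filter_upwards [hfst self_mem_nhdsWithin] with q hq
  rw [hh.setIntegral_starBody hn hq hK, Pi.div_apply, mul_div_assoc]

end IsGauge

/-! ### The circle average and the complex intersection body. -/

section Symmetrization

variable {n : ℕ} {K : Set (Cn n)}

/-- The rotation `v ↦ e^{iθ} v` of the unit sphere. -/
noncomputable def sphereRotation (v : Metric.sphere (0 : Cn n) 1) (θ : ℝ) :
    Metric.sphere (0 : Cn n) 1 :=
  ⟨circleMap 0 1 θ • (v : Cn n), by
    rw [mem_sphere_zero_iff_norm, norm_smul, norm_circleMap_zero, norm_eq_of_mem_sphere, abs_one,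
      mul_one]⟩

theorem continuous_sphereRotation : Continuous
    (Function.uncurry (sphereRotation : Metric.sphere (0 : Cn n) 1 → ℝ → _)) := by
  refine Continuous.subtype_mk ?_ _
  have := continuous_circleMap 0 1
  fun_prop

/-- The average of a function on the unit sphere over the circle action. -/
noncomputable def circleMean (f : C(Metric.sphere (0 : Cn n) 1, ℝ))
    (v : Metric.sphere (0 : Cn n) 1) : ℝ :=
  (2 * Real.pi)⁻¹ * ∫ θ in (0 : ℝ)..2 * Real.pi, f (sphereRotation v θ)

theorem continuous_circleMean (f : C(Metric.sphere (0 : Cn n) 1, ℝ)) :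
    Continuous (circleMean f) := by
  refine continuous_const.mul (intervalIntegral.continuous_parametric_intervalIntegral_of_continuous'
    (f := fun v θ => f (sphereRotation v θ)) ?_ _ _)
  exact f.continuous.comp continuous_sphereRotation

theorem circleMean_pos {f : C(Metric.sphere (0 : Cn n) 1, ℝ)} (hf : ∀ v, 0 < f v)
    (v : Metric.sphere (0 : Cn n) 1) : 0 < circleMean f v := by
  refine mul_pos (by positivity) (intervalIntegral.intervalIntegral_pos_of_pos_on
    (Continuous.intervalIntegrable ?_ _ _) (fun θ _ => hf _) (by positivity))
  have hc : Continuous fun θ => sphereRotation v θ :=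
    continuous_sphereRotation.comp (f := fun θ => (v, θ)) (by fun_prop)
  exact f.continuous.comp hc

/-- Multiplication by `c` shifts the angle by `arg c`, which does not affect the integral over a
full period. -/
theorem circleMean_smul (f : C(Metric.sphere (0 : Cn n) 1, ℝ))
    (v w : Metric.sphere (0 : Cn n) 1) {c : ℂ} (hc : ‖c‖ = 1) (hw : (w : Cn n) = c • (v : Cn n)) :
    circleMean f w = circleMean f v := by
  have hrot (θ : ℝ) : sphereRotation w θ = sphereRotation v (θ + c.arg) := by
    ext1
    change circleMap 0 1 θ • (w : Cn n) = circleMap 0 1 (θ + c.arg) • (v : Cn n)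
    have hexp : Complex.exp (c.arg * Complex.I) = c := by
      simpa [hc] using Complex.norm_mul_exp_arg_mul_I c
    rw [hw, smul_smul]
    congr 1
    simp only [circleMap, zero_add, Complex.ofReal_one, one_mul, Complex.ofReal_add, add_mul,
      Complex.exp_add, hexp]
  have hper : Function.Periodic (fun θ => f (sphereRotation v θ)) (2 * Real.pi) := by
    intro θ
    simp only
    congr 1
    ext1
    change circleMap 0 1 (θ + 2 * Real.pi) • (v : Cn n) = circleMap 0 1 θ • (v : Cn n)
    rw [periodic_circleMap]
  simp only [circleMean, hrot]
  rw [intervalIntegral.integral_comp_add_right (fun θ => f (sphereRotation v θ)), zero_add,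
    add_comm (2 * Real.pi), hper.intervalIntegral_add_eq c.arg 0, zero_add]

/-- After interchanging the integrals, each rotation `e^{iθ}` is an isometry preserving the complex
subspace `u^⊥`, so every angle contributes the same value. -/
theorem complexSphericalRadon_circleMean (hn : 2 ≤ n) (f : C(Metric.sphere (0 : Cn n) 1, ℝ))
    (u : Metric.sphere (0 : Cn n) 1) :
    sphereSectionIntegral (complexHyperplane (u : Cn n)) (circleMean f) =
      complexSphericalRadon f u := by
  have := nontrivial_complexHyperplane hn (norm_eq_of_mem_sphere u)
  obtain ⟨B, hB⟩ := isCompact_univ.bddAbove_image f.continuous.abs.continuousOn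
  have h1 : sphereSectionIntegral (complexHyperplane (u : Cn n)) (circleMean f) =
      (2 * Real.pi)⁻¹ * sphereSectionIntegral (complexHyperplane (u : Cn n))
        fun v => ∫ θ in (0 : ℝ)..2 * Real.pi, f (sphereRotation v θ) :=
    integral_const_mul _ _
  have hrot (θ : ℝ) : sphereSectionIntegral (complexHyperplane (u : Cn n))
      (fun v => f (sphereRotation v θ)) =
        sphereSectionIntegral (complexHyperplane (u : Cn n)) f := by
    let e : Cn n →ₗᵢ[ℝ] Cn n :=
      { toFun := fun x => circleMap 0 1 θ • x
        map_add' := fun x y => smul_add _ x y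
        map_smul' := fun t x => smul_comm _ t x
        norm_map' := fun x => by
          change ‖circleMap 0 1 θ • x‖ = ‖x‖
          rw [norm_smul, norm_circleMap_zero, abs_one, one_mul] }
    refine sphereSectionIntegral_comp_isometry _ e (fun x hx => ?_) _ _ fun v w hw => ?_
    · exact ((Submodule.span ℂ {(u : Cn n)})ᗮ).smul_mem _ hx
    · congr 1
      ext1
      exact hw.symm
  rw [h1, sphereSectionIntegral_intervalIntegral _
    (g := fun v θ => f (sphereRotation v θ)) (f.continuous.comp continuous_sphereRotation)
    (fun v θ => hB (mem_image_of_mem _ (mem_univ _))) (by positivity)]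
  simp only [hrot]
  rw [intervalIntegral.integral_const, smul_eq_mul, sub_zero, inv_mul_cancel_left₀ (by positivity)]
  rfl

theorem circleAverage_radialFun (hK : IsStarBody K) (v : Metric.sphere (0 : Cn n) 1) :
    Real.circleAverage (fun c : ℂ => radialFun K (c • (v : Cn n)) ^ (2 * n - 2)) 0 1 =
      circleMean hK.radialPow v :=
  rfl

theorem isStarBody_circleSymmetrization (hK : IsStarBody K) :
    IsStarBody (circleSymmetrization K) := by
  have hpos := circleMean_pos (f := hK.radialPow) fun v => pow_pos (hK.radialFun_pos v) _
  refine isStarBody_starSet (fun u hu => ?_) ?_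
  · rw [circleAverage_radialFun hK ⟨u, mem_sphere_zero_iff_norm.2 hu⟩]
    exact Real.rpow_pos_of_pos (hpos _) _
  · simp only [circleAverage_radialFun hK]
    exact (continuous_circleMean _).rpow_const fun v => Or.inl (hpos v).ne'

theorem isCircleInvariant_circleSymmetrization (hK : IsStarBody K) :
    IsCircleInvariant (circleSymmetrization K) := by
  refine isCircleInvariant_starSet fun c hc u hu => ?_
  have hcu : ‖c • u‖ = 1 := by rw [norm_smul, hc, hu, one_mul]
  rw [circleAverage_radialFun hK ⟨u, mem_sphere_zero_iff_norm.2 hu⟩,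
    circleAverage_radialFun hK ⟨c • u, mem_sphere_zero_iff_norm.2 hcu⟩,
    circleMean_smul _ ⟨u, _⟩ _ hc rfl]

theorem radialFun_circleSymmetrization_pow (hn : 2 ≤ n) (hK : IsStarBody K)
    (v : Metric.sphere (0 : Cn n) 1) :
    radialFun (circleSymmetrization K) v ^ (2 * n - 2) = circleMean hK.radialPow v := by
  have hpos := circleMean_pos (f := hK.radialPow) (fun v => pow_pos (hK.radialFun_pos v) _) v
  rw [circleSymmetrization, radialFun_starSet _ (norm_eq_of_mem_sphere v),
    circleAverage_radialFun hK, ← Real.rpow_mul_natCast hpos.le]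
  · rw [Nat.cast_sub (by omega)]
    push_cast
    have : (2 : ℝ) ≤ n := by exact_mod_cast hn
    rw [one_div_mul_cancel (by linarith), Real.rpow_one]
  · rw [circleAverage_radialFun hK]
    exact Real.rpow_nonneg hpos.le _

theorem sectionVolume_circleSymmetrization (hn : 2 ≤ n) (hK : IsStarBody K)
    (u : Metric.sphere (0 : Cn n) 1) :
    sectionVolume (complexHyperplane (u : Cn n)) (circleSymmetrization K) =
      ENNReal.ofReal (complexSphericalRadon hK.radialPow u / (2 * n - 2)) := by
  have hu := norm_eq_of_mem_sphere u
  have := nontrivial_complexHyperplane hn hu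
  have hfr : Module.finrank ℝ (complexHyperplane (u : Cn n)) = 2 * n - 2 := by
    have := finrank_complexHyperplane hu
    omega
  have hS := isStarBody_circleSymmetrization hK
  have h1 := sectionVolume_eq (complexHyperplane (u : Cn n)) (K := circleSymmetrization K)
    hS.isCompact.isClosed.measurableSet (ρ := fun v => radialFun (circleSymmetrization K) v)
    (fun v => (hS.radialFun_pos v).le) hS.continuous_radialFun
    fun v r hr => hS.smul_mem_iff (norm_eq_of_mem_sphere v) hr.le
  rw [h1]
  congr 2
  · rw [← complexSphericalRadon_circleMean hn]
    congr 1
    ext v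
    rw [← radialFun_circleSymmetrization_pow hn hK]
    congr 1
  · refine (congrArg Nat.cast hfr).trans ?_
    rw [Nat.cast_sub (by omega)]
    push_cast
    rfl

theorem complexSphericalRadon_radialPow_pos (hn : 2 ≤ n) (hK : IsStarBody K)
    (u : Metric.sphere (0 : Cn n) 1) : 0 < complexSphericalRadon hK.radialPow u := by
  have := nontrivial_complexHyperplane hn (norm_eq_of_mem_sphere u)
  exact sphereSectionIntegral_pos _ hK.radialPow.continuous
    fun v => pow_pos (hK.radialFun_pos v) _

/-- The volume condition reads `π ρ_L(u)² = R(u) / (2n - 2)`, with `R` the Radon transform of `ρ_K ^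
(2n - 2)`, and thus prescribes the radial function. -/
theorem isComplexIntersectionBody_circleSymmetrization_iff (hn : 2 ≤ n) (hK : IsStarBody K)
    {L : Set (Cn n)} : IsComplexIntersectionBody (circleSymmetrization K) L ↔
      IsStarBody L ∧ IsCircleInvariant L ∧ ∀ u : Metric.sphere (0 : Cn n) 1,
        radialFun L u = √(complexSphericalRadon hK.radialPow u / (2 * n - 2) / Real.pi) := by
  have hn' : (2 : ℝ) ≤ n := by exact_mod_cast hn
  have key (hL : IsStarBody L) (hinv : IsCircleInvariant L) (u : Metric.sphere (0 : Cn n) 1) :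
      sectionVolume (complexLine (u : Cn n)) L =
        sectionVolume (complexHyperplane (u : Cn n)) (circleSymmetrization K) ↔
      radialFun L u = √(complexSphericalRadon hK.radialPow u / (2 * n - 2) / Real.pi) := by
    have h0 := hL.radialFun_pos u
    have hV := complexSphericalRadon_radialPow_pos hn hK u
    have hV' : 0 < complexSphericalRadon hK.radialPow u / (2 * n - 2) :=
      div_pos hV (by linarith)
    rw [sectionVolume_complexLine hL hinv (norm_eq_of_mem_sphere u),
      sectionVolume_circleSymmetrization hn hK,
      ENNReal.ofReal_eq_ofReal_iff (by positivity) hV'.le, eq_comm (b := √_),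
      Real.sqrt_eq_iff_eq_sq (by positivity) h0.le, div_eq_iff Real.pi_ne_zero, eq_comm,
      mul_comm Real.pi]
  constructor
  · rintro ⟨h1, h2, h3⟩
    exact ⟨h1, h2, fun u => (key h1 h2 u).1 (h3 u (norm_eq_of_mem_sphere u))⟩
  · rintro ⟨h1, h2, h3⟩
    exact ⟨h1, h2, fun u hu => (key h1 h2 ⟨u, mem_sphere_zero_iff_norm.2 hu⟩).2 (h3 _)⟩

/-- The prescribed radial function is positive and continuous, hence defines a star body, and star
bodies are determined by their radial functions. The gauge supplies continuity of the Radon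
transform. -/
theorem existsUnique_isComplexIntersectionBody {h : ℂ → ℝ} (hh : IsGauge h) (hn : 2 ≤ n)
    (hK : IsStarBody K) : ∃! L, IsComplexIntersectionBody (circleSymmetrization K) L := by
  classical
  have hn' : (2 : ℝ) ≤ n := by exact_mod_cast hn
  let r (u : Metric.sphere (0 : Cn n) 1) : ℝ :=
    √(complexSphericalRadon hK.radialPow u / (2 * n - 2) / Real.pi)
  have hr (u) : 0 < r u := Real.sqrt_pos.2 (div_pos (div_pos
    (complexSphericalRadon_radialPow_pos hn hK u) (by linarith)) Real.pi_pos)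
  have hrc : Continuous r :=
    (((hh.tendstoUniformly_sphericalTransform hn _).2.div_const _).div_const _).sqrt
  let ρ (u : Cn n) : ℝ := if hu : ‖u‖ = 1 then r ⟨u, mem_sphere_zero_iff_norm.2 hu⟩ else 0
  have hρ (u : Metric.sphere (0 : Cn n) 1) : ρ u = r u := dif_pos (norm_eq_of_mem_sphere u)
  have hpos (u : Cn n) (hu : ‖u‖ = 1) : 0 < ρ u :=
    (hr ⟨u, mem_sphere_zero_iff_norm.2 hu⟩).trans_eq (hρ _).symm
  refine ⟨starSet ρ, (isComplexIntersectionBody_circleSymmetrization_iff hn hK).2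
    ⟨isStarBody_starSet hpos (hrc.congr fun u => (hρ u).symm),
      isCircleInvariant_starSet fun c hc u hu => ?_, fun u => ?_⟩, fun L hL => ?_⟩
  · have hc0 : c ≠ 0 := fun h0 => by simp [h0] at hc
    have hcu : ‖c • u‖ = 1 := by rw [norm_smul, hc, hu, one_mul]
    simp only [ρ, dif_pos hu, dif_pos hcu, r, complexSphericalRadon, complexHyperplane_smul hc0]
  · rw [radialFun_starSet ρ (norm_eq_of_mem_sphere u) (hpos u (norm_eq_of_mem_sphere u)).le, hρ]
  · obtain ⟨h1, -, h3⟩ := (isComplexIntersectionBody_circleSymmetrization_iff hn hK).1 hL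
    refine h1.ext (isStarBody_starSet hpos (hrc.congr fun u => (hρ u).symm)) fun u hu => ?_
    rw [radialFun_starSet ρ hu (hpos u hu).le, h3 ⟨u, mem_sphere_zero_iff_norm.2 hu⟩]
    exact (hρ ⟨u, mem_sphere_zero_iff_norm.2 hu⟩).symm

end Symmetrization

/-! ### The limit of the intersection bodies. -/

theorem isStarBody_complexLpIntersectionBody {C : Set ℂ} (hh : IsGauge (supportFun C)) {n : ℕ}
    {K : Set (Cn n)} (hK : IsStarBody K) {p : ℝ} (hp : -2 < p) :
    IsStarBody (complexLpIntersectionBody C p K) := by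
  simp only [complexLpIntersectionBody, supportFun_bodyMul]
  have hpos := hh.setIntegral_starBody_pos hp hK
  refine isStarBody_starSet (fun u hu => ?_) ?_
  · exact Real.rpow_pos_of_pos (hpos ⟨u, mem_sphere_zero_iff_norm.2 hu⟩) _
  · exact (hh.continuous_setIntegral_starBody hp hK).rpow_const fun u => Or.inl (hpos u).ne'

theorem tendstoRadially_complexLpIntersectionBody {C : Set ℂ} (hh : IsGauge (supportFun C)) {n : ℕ}
    (hn : 2 ≤ n) {K L : Set (Cn n)} (hK : IsStarBody K)
    (hL : IsComplexIntersectionBody (circleSymmetrization K) L) :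
    TendstoRadially (fun p : ℝ => ((1 / Real.Gamma (p + 2)) ^ (-1 / p)) •
      complexLpIntersectionBody C p K) (𝓝[>] (-2))
      (√(Real.pi * gaugeMass (supportFun C)) • L) := by
  have hn' : (2 : ℝ) ≤ n := by exact_mod_cast hn
  have hc := hh.gaugeMass_pos
  have hk : 0 < √(Real.pi * gaugeMass (supportFun C)) := Real.sqrt_pos.2 (by positivity)
  obtain ⟨hL1, -, hL3⟩ := (isComplexIntersectionBody_circleSymmetrization_iff hn hK).1 hL
  have hlimc : Continuous fun u : Metric.sphere (0 : Cn n) 1 =>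
      radialFun (√(Real.pi * gaugeMass (supportFun C)) • L) u := by
    simp only [radialFun_smul hk]
    exact continuous_const.mul hL1.continuous_radialFun
  rw [TendstoRadially, tendstoUniformlyOn_iff_tendstoUniformly_comp_coe]
  refine (tendstoUniformly_iff_forall_tendsto_nhds hlimc).2 fun u => ?_
  have hfst : Tendsto (Prod.fst : ℝ × Metric.sphere (0 : Cn n) 1 → ℝ) (𝓝[>] (-2) ×ˢ 𝓝 u)
    (𝓝[>] (-2)) := tendsto_fst
  have hp0 : Tendsto (Prod.fst : ℝ × Metric.sphere (0 : Cn n) 1 → ℝ) (𝓝[>] (-2) ×ˢ 𝓝 u)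
    (𝓝 (-2)) := hfst.mono_right nhdsWithin_le_nhds
  have hR := complexSphericalRadon_radialPow_pos hn hK u
  have hlim0 : 0 < gaugeMass (supportFun C) * complexSphericalRadon hK.radialPow u / (2 * n - 2) :=
    div_pos (by positivity) (by linarith)
  have hexp : Tendsto (fun q : ℝ × Metric.sphere (0 : Cn n) 1 => -1 / q.1)
      (𝓝[>] (-2) ×ˢ 𝓝 u) (𝓝 (-1 / -2)) := tendsto_const_nhds.div hp0 (by norm_num)
  have key := (hh.tendsto_setIntegral_starBody hn hK u).rpow hexp (Or.inl hlim0.ne')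
  -- The constant: `m R / (2n - 2) = (π m) (R / (2n - 2) / π)`, and the square root of the last
  -- factor is the radial function of `L`.
  have hval : radialFun (√(Real.pi * gaugeMass (supportFun C)) • L) u =
      (gaugeMass (supportFun C) * complexSphericalRadon hK.radialPow u / (2 * n - 2)) ^
        (-1 / -2 : ℝ) := by
    rw [radialFun_smul hk, hL3, ← Real.sqrt_mul (by positivity), neg_div_neg_eq,
      ← Real.sqrt_eq_rpow]
    congr 1
    have := Real.pi_pos
    field_simp
  rw [hval]
  refine key.congr' ?_
  filter_upwards [hfst self_mem_nhdsWithin] with q hq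
  have hq : -2 < q.1 := hq
  have hΓ := Real.Gamma_pos_of_pos (show 0 < q.1 + 2 by linarith)
  have hI := hh.setIntegral_starBody_pos hq hK q.2
  rw [radialFun_smul (Real.rpow_pos_of_pos (by positivity) _), complexLpIntersectionBody]
  simp only [supportFun_bodyMul]
  rw [radialFun_starSet _ (norm_eq_of_mem_sphere q.2) (Real.rpow_nonneg hI.le _),
    Real.mul_rpow (by positivity) hI.le]

theorem theoremA (C : ConvexBody ℂ) (hC : (0 : ℂ) ∈ interior (C : Set ℂ)) :
    (∃ k : ℝ, 0 < k ∧ ∀ n : ℕ, 2 ≤ n → ∀ K : Set (Cn n), IsStarBody K →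
      (∀ p : ℝ, -2 < p → p < 1 → p ≠ 0 →
        IsStarBody (complexLpIntersectionBody (C : Set ℂ) p K)) ∧
      IsStarBody (circleSymmetrization K) ∧
      IsCircleInvariant (circleSymmetrization K) ∧
      (∃! L : Set (Cn n), IsComplexIntersectionBody (circleSymmetrization K) L) ∧
      ∀ L : Set (Cn n), IsComplexIntersectionBody (circleSymmetrization K) L →
        TendstoRadially
          (fun p : ℝ => ((1 / Real.Gamma (p + 2)) ^ (-1 / p)) •
            complexLpIntersectionBody (C : Set ℂ) p K)
          (𝓝[>] (-2)) (k • L)) ∧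
    (∃ k' : ℝ, 0 < k' ∧ ∀ n : ℕ, 2 ≤ n → ∀ f : C(Metric.sphere (0 : Cn n) 1, ℝ),
      TendstoUniformly
        (fun (p : ℝ) (u : Metric.sphere (0 : Cn n) 1) =>
          1 / Real.Gamma (p + 2) * sphericalTransform (C : Set ℂ) p f u)
        (fun u => k' * complexSphericalRadon f u)
        (𝓝[>] (-2))) := by
  have hh := isGauge_supportFun C hC
  have hc := hh.gaugeMass_pos
  refine ⟨⟨√(Real.pi * gaugeMass (supportFun (C : Set ℂ))), Real.sqrt_pos.2 (by positivity),
    fun n hn K hK => ⟨fun p hp _ _ => isStarBody_complexLpIntersectionBody hh hK hp,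
      isStarBody_circleSymmetrization hK, isCircleInvariant_circleSymmetrization hK,
      existsUnique_isComplexIntersectionBody hh hn hK,
      fun L hL => tendstoRadially_complexLpIntersectionBody hh hn hK hL⟩⟩,
    gaugeMass (supportFun (C : Set ℂ)), hc, fun n hn f => ?_⟩
  exact (hh.tendstoUniformly_sphericalTransform hn f).1
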